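/- Let $M\subseteq\mathbb R^n$ be a smooth real affine algebraic variety, i.e. the set of common real zeros of a family of real polynomials which is nonsingular at each of its points: every $x\in M$ has a Zariski open neighbourhood in $\mathbb R^n$ on which $M$ is the zero set of polynomials $f_1,\dots,f_c$ vanishing on $M$ whose gradients at $x$ are linearly independent ($c$ may depend on $x$; $M$ need be neither irreducible nor of pure dimension). In particular $M$ is a closed Nash (smooth semi-algebraic) submanifold of $\mathbb R^n$. Let $C^\infty(M)$ be the algebra of real-valued smooth functions on $M$. A Nash function on $M$ is a smooth function $M\to\mathbb R$ whose graph is semi-algebraic, and a Nash vector field on $M$ is a tangent vector field on $M$ whose components in $\mathbb R^n$ are Nash functions. The algebra of Nash differential operators on $M$ is the unital subalgebra of $\mathrm{Hom}_{\mathbb R}(C^\infty(M),C^\infty(M))$ generated by multiplications by Nash functions and derivations along Nash vector fields. The algebra of algebraic differential operators on $M$ is the unital subalgebra generated by multiplications by (restrictions to $M$ of) polynomials and derivations along algebraic vector fields, i.e. tangent vector fields on $M$ whose components are polynomial functions on $M$. For a closed Nash submanifold $M$ of $\mathbb R^n$, the space of Schwartz functions is $$\mathcal S(M)=\{\varphi\in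 C^\infty(M) : D\varphi \text{ is bounded on } M \text{ for every Nash differential operator } D \text{ on } M\}.$$ Then $$\mathcal S(M)=\{\varphi\in C^\infty(M) : D\varphi \text{ is bounded on } M \text{ for every algebraic differential operator } D \text{ on } M\}.$$ In particular, for every $n\ge 0$, $\mathcal S(\mathbb R^n)$ is the space of classical (real-valued) Schwartz functions on $\mathbb R^n$. -/

import Mathlib

open Filter Topology
open scoped ContDiff SchwartzMap

noncomputable section

/-- A subset of `ℝᵏ` is semi-algebraic if it is a finite union of sets, each of which is given by
finitely many strict polynomial inequalities `f > 0` and finitely many polynomial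
equations `g = 0`. -/
def IsSemialgebraic {k : ℕ} (A : Set (Fin k → ℝ)) : Prop :=
  ∃ (r : ℕ) (F G : Fin r → Finset (MvPolynomial (Fin k) ℝ)),
    A = ⋃ i : Fin r, {x | (∀ f ∈ F i, 0 < MvPolynomial.eval x f) ∧
      ∀ g ∈ G i, MvPolynomial.eval x g = 0}

/-- The value of a polynomial in `n` variables at a point of `ℝⁿ`. -/
def polyEval {n : ℕ} (p : MvPolynomial (Fin n) ℝ) (x : EuclideanSpace ℝ (Fin n)) : ℝ :=
  MvPolynomial.eval (fun i => x i) p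

/-- `M ⊆ ℝⁿ` is nonsingular at `x`: on a Zariski open neighbourhood `{h ≠ 0}` of `x`, the set `M`
is cut out by polynomials `f₁, …, f_c` that vanish on all of `M` and whose gradients at `x` are
linearly independent (the Jacobian criterion; for a real algebraic set `M` it says that the local
ring of `M` at `x` is regular). -/
def IsNonsingularAt {n : ℕ} (M : Set (EuclideanSpace ℝ (Fin n)))
    (x : EuclideanSpace ℝ (Fin n)) : Prop :=
  ∃ (c : ℕ) (f : Fin c → MvPolynomial (Fin n) ℝ) (h : MvPolynomial (Fin n) ℝ),
    (∀ i, ∀ y ∈ M, polyEval (f i) y = 0) ∧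
    LinearIndependent ℝ (fun (i : Fin c) (j : Fin n) => polyEval (MvPolynomial.pderiv j (f i)) x) ∧
    polyEval h x ≠ 0 ∧
    ∀ y, polyEval h y ≠ 0 → (∀ i, polyEval (f i) y = 0) → y ∈ M

/-- A smooth real affine algebraic variety (embedded in `ℝⁿ`): the set of common zeros in `ℝⁿ` of
a set of real polynomials, nonsingular at each of its points. -/
structure IsSmoothRealAffineVariety {n : ℕ} (M : Set (EuclideanSpace ℝ (Fin n))) : Prop where
  algebraic : ∃ S : Set (MvPolynomial (Fin n) ℝ), M = {x | ∀ p ∈ S, polyEval p x = 0}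
  nonsingular : ∀ x ∈ M, IsNonsingularAt M x

/-- `g` is a smooth function on `ℝⁿ` that extends `φ : M → ℝ` near `x ∈ M`. -/
def IsSmoothExtensionAt {n : ℕ} {M : Set (EuclideanSpace ℝ (Fin n))} (φ : M → ℝ) (x : M)
    (g : EuclideanSpace ℝ (Fin n) → ℝ) : Prop :=
  ContDiff ℝ ∞ g ∧ ∀ᶠ y : M in 𝓝 x, φ y = g y

lemma IsSmoothExtensionAt.op₂ {n : ℕ} {M : Set (EuclideanSpace ℝ (Fin n))} {φ ψ : M → ℝ} {x : M}
    {g h : EuclideanSpace ℝ (Fin n) → ℝ} (hg : IsSmoothExtensionAt φ x g)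
    (hh : IsSmoothExtensionAt ψ x h) :
    IsSmoothExtensionAt (φ + ψ) x (g + h) ∧ IsSmoothExtensionAt (φ * ψ) x (g * h) := by
  refine ⟨⟨hg.1.add hh.1, ?_⟩, ⟨hg.1.mul hh.1, ?_⟩⟩ <;>
    filter_upwards [hg.2, hh.2] with y h1 h2 <;> simp [h1, h2]

/-- The algebra `C^∞(M)` of real-valued smooth functions on a smooth submanifold `M` of `ℝⁿ`:
functions that extend, near each point of `M`, to a smooth function on `ℝⁿ`. -/
def SmoothFun {n : ℕ} (M : Set (EuclideanSpace ℝ (Fin n))) : Subalgebra ℝ (M → ℝ) where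
  carrier := {φ | ∀ x : M, ∃ g, IsSmoothExtensionAt φ x g}
  add_mem' ha hb x := by
    obtain ⟨g, hg⟩ := ha x
    obtain ⟨h, hh⟩ := hb x
    exact ⟨_, (hg.op₂ hh).1⟩
  mul_mem' ha hb x := by
    obtain ⟨g, hg⟩ := ha x
    obtain ⟨h, hh⟩ := hb x
    exact ⟨_, (hg.op₂ hh).2⟩
  algebraMap_mem' r _ := ⟨fun _ => r, contDiff_const, Eventually.of_forall fun _ => rfl⟩

/-- The differential at `x` of a local extension of a function on `M` is determined by the function
on all vectors tangent to `M` at `x`. -/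
lemma IsSmoothExtensionAt.fderiv_eq {n : ℕ} {M : Set (EuclideanSpace ℝ (Fin n))} {φ : M → ℝ}
    {x : M} {g h : EuclideanSpace ℝ (Fin n) → ℝ} (hg : IsSmoothExtensionAt φ x g)
    (hh : IsSmoothExtensionAt φ x h) {v : EuclideanSpace ℝ (Fin n)}
    (hv : v ∈ tangentConeAt ℝ M (x : EuclideanSpace ℝ (Fin n))) :
    fderiv ℝ g x v = fderiv ℝ h x v := by
  have hg' : HasFDerivWithinAt g (fderiv ℝ g x) M x :=
    ((hg.1.differentiable (by simp)) _).hasFDerivAt.hasFDerivWithinAt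
  have hh' : HasFDerivWithinAt h (fderiv ℝ h x) M x :=
    ((hh.1.differentiable (by simp)) _).hasFDerivAt.hasFDerivWithinAt
  have hev : g =ᶠ[𝓝[M] (x : EuclideanSpace ℝ (Fin n))] h := by
    rw [← map_nhds_subtype_val]
    exact Filter.eventually_map.2 (by
      filter_upwards [hg.2, hh.2] with y h1 h2
      rw [← h1, ← h2])
  exact hg'.unique_on (hh'.congr_of_eventuallyEq hev (hev.self_of_nhdsWithin x.2)) hv

/-- A smooth vector field on a smooth submanifold `M` of `ℝⁿ`, as an `ℝⁿ`-valued function on `M`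
with smooth components which is tangent to `M` at each point. For a submanifold the tangent cone
is the tangent space. -/
structure SmoothVectorField {n : ℕ} (M : Set (EuclideanSpace ℝ (Fin n))) where
  toFun : M → EuclideanSpace ℝ (Fin n)
  smooth : ∀ i : Fin n, (fun x => toFun x i) ∈ SmoothFun M
  tangent : ∀ x : M, toFun x ∈ tangentConeAt ℝ M (x : EuclideanSpace ℝ (Fin n))

/-- The value at `x` of the derivative of `φ ∈ C^∞(M)` along `X`: the differential at `x` of a
smooth extension of `φ` near `x`, applied to `X x`. -/
def SmoothVectorField.derivFun {n : ℕ} {M : Set (EuclideanSpace ℝ (Fin n))}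
    (X : SmoothVectorField M) (φ : SmoothFun M) (x : M) : ℝ :=
  fderiv ℝ (Classical.choose (φ.2 x)) (x : EuclideanSpace ℝ (Fin n)) (X.toFun x)

/-- The derivative along `X` may be computed with any local smooth extension. -/
lemma SmoothVectorField.derivFun_eq {n : ℕ} {M : Set (EuclideanSpace ℝ (Fin n))}
    (X : SmoothVectorField M) (φ : SmoothFun M) (x : M) {g : EuclideanSpace ℝ (Fin n) → ℝ}
    (hg : IsSmoothExtensionAt φ.1 x g) :
    X.derivFun φ x = fderiv ℝ g (x : EuclideanSpace ℝ (Fin n)) (X.toFun x) :=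
  (Classical.choose_spec (φ.2 x)).fderiv_eq hg (X.tangent x)

lemma SmoothVectorField.derivFun_mem {n : ℕ} {M : Set (EuclideanSpace ℝ (Fin n))}
    (X : SmoothVectorField M) (φ : SmoothFun M) : X.derivFun φ ∈ SmoothFun M := by
  intro x
  obtain ⟨g, hg⟩ := φ.2 x
  choose Y hY using fun i => X.smooth i x
  refine ⟨fun y => ∑ i, Y i y * fderiv ℝ g y (EuclideanSpace.single i 1), ?_, ?_⟩
  · exact ContDiff.sum fun i _ => (hY i).1.mul
      ((hg.1.fderiv_right (m := ∞) (by simp)).clm_apply contDiff_const)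
  · have hYe : ∀ᶠ y : M in 𝓝 x, ∀ i, X.toFun y i = Y i y :=
      Filter.eventually_all.2 fun i => (hY i).2
    filter_upwards [hYe, hg.2.eventually_nhds] with y hy1 hy2
    rw [X.derivFun_eq φ y ⟨hg.1, hy2⟩]
    have hdec : X.toFun y = ∑ i, X.toFun y i • EuclideanSpace.single i (1 : ℝ) := by
      ext j
      simp [Finset.sum_apply, Pi.single_apply]
    conv_lhs => rw [hdec]
    simp [map_sum, hy1]

/-- The derivation of `C^∞(M)` along a smooth vector field, as an element of
`Hom_ℝ(C^∞(M), C^∞(M))`. -/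
def SmoothVectorField.derivation {n : ℕ} {M : Set (EuclideanSpace ℝ (Fin n))}
    (X : SmoothVectorField M) : Module.End ℝ (SmoothFun M) where
  toFun φ := ⟨X.derivFun φ, X.derivFun_mem φ⟩
  map_add' φ ψ := by
    ext x
    obtain ⟨g, hg⟩ := φ.2 x
    obtain ⟨h, hh⟩ := ψ.2 x
    change X.derivFun (φ + ψ) x = X.derivFun φ x + X.derivFun ψ x
    rw [X.derivFun_eq φ x hg, X.derivFun_eq ψ x hh, X.derivFun_eq (φ + ψ) x (hg.op₂ hh).1,
      fderiv_add ((hg.1.differentiable (by simp)) _) ((hh.1.differentiable (by simp)) _)]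
    rfl
  map_smul' r φ := by
    ext x
    obtain ⟨g, hg⟩ := φ.2 x
    have hr : IsSmoothExtensionAt (r • φ : SmoothFun M).1 x (r • g) := by
      refine ⟨hg.1.const_smul r, ?_⟩
      filter_upwards [hg.2] with y hy
      change r * φ.1 y = r * g y
      rw [hy]
    change X.derivFun (r • φ) x = r * X.derivFun φ x
    rw [X.derivFun_eq φ x hg, X.derivFun_eq (r • φ) x hr,
      fderiv_const_smul ((hg.1.differentiable (by simp)) _)]
    rfl

/-- A real function on `M ⊆ ℝⁿ` is semi-algebraic if its graph is semi-algebraic in `ℝⁿ⁺¹`. -/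
def IsSemialgebraicFun {n : ℕ} {M : Set (EuclideanSpace ℝ (Fin n))} (f : M → ℝ) : Prop :=
  IsSemialgebraic {z : Fin (n + 1) → ℝ |
    ∃ x : M, z = Fin.snoc (α := fun _ => ℝ) (fun i => x.1 i) (f x)}

/-- A Nash function on a Nash submanifold of `ℝⁿ`: a smooth semi-algebraic function. -/
def IsNashFun {n : ℕ} {M : Set (EuclideanSpace ℝ (Fin n))} (f : M → ℝ) : Prop :=
  f ∈ SmoothFun M ∧ IsSemialgebraicFun f

/-- A polynomial function on `M ⊆ ℝⁿ`: the restriction to `M` of a polynomial. -/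
def IsPolynomialFun {n : ℕ} {M : Set (EuclideanSpace ℝ (Fin n))} (f : M → ℝ) : Prop :=
  ∃ p : MvPolynomial (Fin n) ℝ, ∀ x : M, f x = polyEval p x

/-- The algebra of Nash differential operators on a Nash submanifold `M` of `ℝⁿ`: the subalgebra
with 1 of `Hom_ℝ(C^∞(M), C^∞(M))` generated by the multiplications by Nash functions and the
derivations along Nash vector fields. -/
def nashDiffOp {n : ℕ} (M : Set (EuclideanSpace ℝ (Fin n))) :
    Subalgebra ℝ (Module.End ℝ (SmoothFun M)) :=
  Algebra.adjoin ℝ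
    ({D | ∃ f : SmoothFun M, IsNashFun f.1 ∧ D = LinearMap.mulLeft ℝ f} ∪
     {D | ∃ X : SmoothVectorField M, (∀ i, IsNashFun fun x => X.toFun x i) ∧ D = X.derivation})

/-- The algebra of algebraic differential operators on a smooth real affine algebraic variety
`M ⊆ ℝⁿ`: the subalgebra with 1 of `Hom_ℝ(C^∞(M), C^∞(M))` generated by the multiplications by
polynomial functions and the derivations along algebraic (i.e. polynomial) vector fields. -/
def algebraicDiffOp {n : ℕ} (M : Set (EuclideanSpace ℝ (Fin n))) :
    Subalgebra ℝ (Module.End ℝ (SmoothFun M)) :=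
  Algebra.adjoin ℝ
    ({D | ∃ f : SmoothFun M, IsPolynomialFun f.1 ∧ D = LinearMap.mulLeft ℝ f} ∪
     {D | ∃ X : SmoothVectorField M, (∀ i, IsPolynomialFun fun x => X.toFun x i) ∧
       D = X.derivation})

/-- The Schwartz functions on a closed Nash submanifold `M` of `ℝⁿ`: the smooth functions `φ` on
`M` such that `D φ` is bounded for every Nash differential operator `D` on `M`. -/
def schwartzFun {n : ℕ} (M : Set (EuclideanSpace ℝ (Fin n))) : Set (SmoothFun M) :=
  {φ | ∀ D ∈ nashDiffOp M, ∃ C : ℝ, ∀ x : M, |(D φ).1 x| ≤ C}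

end

/-! One inclusion holds because polynomial functions on `M` are Nash: an algebraic set is
semi-algebraic. For the other, every Nash differential operator is shown to be a finite sum of
operators `f · D` with `f` Nash and `D` algebraic (`nashDiffOp_subset_nashSpan`). A Nash function on
a closed set is bounded by some `C * (1 + ‖x‖ ^ 2) ^ N` (`IsNashFun.exists_abs_le`), and
multiplication by `(1 + ‖x‖ ^ 2) ^ N` is an algebraic operator, so boundedness of all algebraic
derivatives of `φ` bounds `f · D φ` as well.

The decomposition needs two facts. Nash vector fields are combinations, with Nash coefficients, of
finitely many polynomial ones (`exists_generating_vectorFields`): near a nonsingular point the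
orthogonal projection onto the kernel of the Jacobian, with denominators cleared, gives polynomial
tangent fields; noetherianity leaves finitely many such frames, and a sum of squares of their
denominators has no zero on `M`. Moreover a polynomial vector field maps Nash functions to Nash
functions (`IsNashFun.derivFun`), so the Leibniz rule moves Nash coefficients to the left.

That derivatives are semi-algebraic, and the growth bound, rest on the Tarski–Seidenberg principle.
It is proved by the Cohen–Hörmander method (`signsDetermined`): the signs of finitely many elements
of the coefficient ring determine, up to an increasing bijection of the line, the arrangement of the
signs of finitely many univariate polynomials.

For `M = ℝⁿ`, the algebraic description is compared with the Schwartz seminorms, by expressing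
iterated derivatives through partial derivatives. -/

/-! ### Signs of real polynomials in one variable -/

open Polynomial in
lemma Polynomial.sign_eval_eq_of_forall_ne_zero {p : ℝ[X]} {u v : ℝ}
    (h : ∀ x ∈ Set.uIcc u v, p.eval x ≠ 0) :
    SignType.sign (p.eval u) = SignType.sign (p.eval v) := by
  have hc : ContinuousOn (fun x => p.eval x) (Set.uIcc u v) := p.continuous.continuousOn
  have hi := intermediate_value_uIcc hc
  have h0 : (0 : ℝ) ∉ Set.uIcc (p.eval u) (p.eval v) := fun h0 => by
    obtain ⟨x, hx, hx0⟩ := hi h0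
    exact h x hx hx0
  rw [Set.mem_uIcc] at h0
  push Not at h0
  rcases lt_trichotomy (p.eval u) 0 with hu | hu | hu
  · rw [sign_neg hu, sign_neg (h0.1 hu.le)]
  · exact absurd hu (h u Set.left_mem_uIcc)
  · rcases lt_trichotomy (p.eval v) 0 with hv | hv | hv
    · exact absurd (h0.2 hv.le) (not_lt.2 hu.le)
    · exact absurd hv (h v Set.right_mem_uIcc)
    · rw [sign_pos hu, sign_pos hv]

-- The hypothesis also allows both signs to be zero, and then the endpoints themselves are roots.
open Polynomial in
lemma Polynomial.exists_root_of_sign_eq_neg {p : ℝ[X]} {u v : ℝ}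
    (h : SignType.sign (p.eval u) = -SignType.sign (p.eval v)) :
    ∃ x ∈ Set.uIcc u v, p.eval x = 0 := by
  by_contra! hn
  have h1 := Polynomial.sign_eval_eq_of_forall_ne_zero hn
  have h2 : SignType.sign (p.eval v) ≠ 0 := by simpa using hn v Set.right_mem_uIcc
  rw [h1] at h
  revert h h2
  generalize SignType.sign (p.eval v) = s
  revert s
  decide

open Polynomial in
/-- The mean value theorem for the sign of an increment of a polynomial. -/
lemma Polynomial.sign_eval_sub_eval {p : ℝ[X]} {s t u : ℝ} (hst : s < t) (hu : u ∈ Set.Icc s t)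
    (hu0 : p.derivative.eval u ≠ 0) (h : ∀ x ∈ Set.Ioo s t, p.derivative.eval x ≠ 0) :
    SignType.sign (p.eval t - p.eval s) = SignType.sign (p.derivative.eval u) := by
  obtain ⟨c, hc, hc'⟩ := exists_deriv_eq_slope (fun x => p.eval x) hst p.continuous.continuousOn
    p.differentiable.differentiableOn
  rw [Polynomial.deriv, eq_div_iff (sub_pos.2 hst).ne'] at hc'
  have hts : SignType.sign (t - s) = 1 := sign_pos (sub_pos.2 hst)
  rw [← hc', sign_mul, hts, mul_one]
  refine Polynomial.sign_eval_eq_of_forall_ne_zero fun x hx => ?_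
  by_cases hxu : x = u
  · rwa [hxu]
  · refine h x ?_
    rw [Set.mem_uIcc] at hx
    simp only [Set.mem_Ioo, Set.mem_Icc] at *
    rcases hx with hx | hx
    · exact ⟨hc.1.trans_le hx.1, (lt_of_le_of_ne hx.2 hxu).trans_le hu.2⟩
    · exact ⟨hu.1.trans_lt (lt_of_le_of_ne hx.1 (Ne.symm hxu)), hx.2.trans_lt hc.2⟩

lemma sign_eq_sign_sub_of_abs_lt {a b : ℝ} (h : |b| < |a|) :
    SignType.sign a = SignType.sign (a - b) := by
  rcases lt_trichotomy a 0 with ha | ha | ha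
  · rw [abs_of_neg ha] at h
    rw [sign_neg ha, sign_neg (by linarith [neg_abs_le b])]
  · rw [ha, abs_zero] at h
    exact absurd h (not_lt.2 (abs_nonneg b))
  · rw [abs_of_pos ha] at h
    rw [sign_pos ha, sign_pos (by linarith [le_abs_self b])]

open Polynomial in
lemma Polynomial.degree_pos_of_derivative_eval_ne_zero {p : ℝ[X]} {u : ℝ}
    (h : p.derivative.eval u ≠ 0) : 0 < p.degree := by
  by_contra hd
  rw [Polynomial.eq_C_of_degree_le_zero (not_lt.1 hd)] at h
  simp at h

-- Serves in place of a next critical point when there is none. Far out `|p|` exceeds `|p.eval u|`,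
-- so the sign of `p` there is that of its increment from `u`, which the mean value theorem gives.
open Polynomial in
lemma Polynomial.exists_gt_sign_eq_sign_derivative {p : ℝ[X]} {u : ℝ}
    (h : ∀ x, u ≤ x → p.derivative.eval x ≠ 0) :
    ∃ s, u < s ∧ SignType.sign (p.eval s) = SignType.sign (p.derivative.eval u) := by
  have ht := p.abs_tendsto_atTop (degree_pos_of_derivative_eval_ne_zero (h u le_rfl))
  obtain ⟨s, hs, hus⟩ := ((ht.eventually_gt_atTop |p.eval u|).and (eventually_gt_atTop u)).exists
  refine ⟨s, hus, ?_⟩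
  rw [sign_eq_sign_sub_of_abs_lt hs]
  exact sign_eval_sub_eval hus ⟨le_rfl, hus.le⟩ (h u le_rfl) fun x hx => h x hx.1.le

open Polynomial in
lemma Polynomial.exists_lt_sign_eq_neg_sign_derivative {p : ℝ[X]} {u : ℝ}
    (h : ∀ x, x ≤ u → p.derivative.eval x ≠ 0) :
    ∃ s, s < u ∧ SignType.sign (p.eval s) = -SignType.sign (p.derivative.eval u) := by
  have ht := p.abs_tendsto_atBot (degree_pos_of_derivative_eval_ne_zero (h u le_rfl))
  obtain ⟨s, hs, hus⟩ := ((ht.eventually_gt_atTop |p.eval u|).and (eventually_lt_atBot u)).exists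
  refine ⟨s, hus, ?_⟩
  rw [sign_eq_sign_sub_of_abs_lt hs, ← neg_sub, Left.sign_neg, neg_inj]
  exact sign_eval_sub_eval hus ⟨hus.le, le_rfl⟩ (h u le_rfl) fun x hx => h x hx.2.le

/-! ### Increasing bijections of the line supported in an interval -/

lemma exists_orderIso_bump_of_le {a u v b : ℝ} (hau : a < u) (huv : u ≤ v) (hvb : v < b) :
    ∃ η : ℝ ≃o ℝ, η u = v ∧ ∀ x, x ≤ a ∨ b ≤ x → η x = x := by
  set c₁ := (v - a) / (u - a) with hc₁
  set c₂ := (b - v) / (b - u) with hc₂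
  have h1 : 0 < u - a := sub_pos.2 hau
  have h2 : 0 < b - u := sub_pos.2 (huv.trans_lt hvb)
  have hc1 : 1 ≤ c₁ := (one_le_div h1).2 (by linarith)
  have hc2 : c₂ ≤ 1 := (div_le_one h2).2 (by linarith)
  have hc2' : 0 < c₂ := div_pos (sub_pos.2 hvb) h2
  have e1 : c₁ * (u - a) = v - a := div_mul_cancel₀ _ h1.ne'
  have e2 : c₂ * (b - u) = b - v := div_mul_cancel₀ _ h2.ne'
  -- The two affine functions are the lines through `(a, a)`, `(u, v)` and through `(u, v)`, `(b,
  -- b)`. Their slopes satisfy `c₂ ≤ 1 ≤ c₁`, so outside `(a, b)` the identity wins the maximum.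
  let f : ℝ → ℝ := fun x => max x (min (a + c₁ * (x - a)) (b - c₂ * (b - x)))
  have hmono : StrictMono f := by
    intro x y hxy
    have k1 : a + c₁ * (x - a) < a + c₁ * (y - a) := by
      have := mul_lt_mul_of_pos_left hxy (lt_of_lt_of_le one_pos hc1); linarith
    have k2 : b - c₂ * (b - x) < b - c₂ * (b - y) := by
      have := mul_lt_mul_of_pos_left hxy hc2'; linarith
    exact max_lt_max hxy (min_lt_min k1 k2)
  have hle : ∀ x, x ≤ f x := fun x => le_max_left _ _
  have hfix : ∀ x, x ≤ a ∨ b ≤ x → f x = x := by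
    intro x hx
    refine max_eq_left ?_
    rcases hx with hx | hx
    · exact (min_le_left _ _).trans (by nlinarith)
    · exact (min_le_right _ _).trans (by nlinarith)
  have hcont : Continuous f := by fun_prop
  have hsurj : Function.Surjective f := by
    refine hcont.surjective (tendsto_atTop_mono hle tendsto_id) ?_
    refine tendsto_id.congr' ?_
    filter_upwards [eventually_le_atBot a] with x hx using (hfix x (Or.inl hx)).symm
  refine ⟨hmono.orderIsoOfSurjective f hsurj, ?_, hfix⟩
  change max u (min _ _) = v
  rw [e1, e2]
  simp [huv]

lemma exists_orderIso_bump {a u v b : ℝ} (hau : a < u) (hav : a < v) (hub : u < b) (hvb : v < b) :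
    ∃ η : ℝ ≃o ℝ, η u = v ∧ ∀ x, x ≤ a ∨ b ≤ x → η x = x := by
  rcases le_total u v with h | h
  · exact exists_orderIso_bump_of_le hau h hvb
  · obtain ⟨η, h1, h2⟩ := exists_orderIso_bump_of_le hav h hub
    refine ⟨η.symm, by rw [← h1, η.symm_apply_apply], fun x hx => ?_⟩
    rw [η.symm_apply_eq, h2 x hx]

lemma Set.Finite.exists_max_lt_or {Z : Set ℝ} (hZ : Z.Finite) (w : ℝ) :
    (∃ a ∈ Z, a < w ∧ ∀ z ∈ Z, z < w → z ≤ a) ∨ ∀ z ∈ Z, w ≤ z := by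
  by_cases h : (Z ∩ Set.Iio w).Nonempty
  · obtain ⟨a, ha, hmax⟩ := Set.exists_max_image _ id (hZ.inter_of_left (Set.Iio w)) h
    exact Or.inl ⟨a, ha.1, ha.2, fun z hz hzw => hmax z ⟨hz, hzw⟩⟩
  · exact Or.inr fun z hz => not_lt.1 fun hzw => h ⟨z, hz, hzw⟩

lemma Set.Finite.exists_min_gt_or {Z : Set ℝ} (hZ : Z.Finite) (w : ℝ) :
    (∃ b ∈ Z, w < b ∧ ∀ z ∈ Z, w < z → b ≤ z) ∨ ∀ z ∈ Z, z ≤ w := by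
  by_cases h : (Z ∩ Set.Ioi w).Nonempty
  · obtain ⟨a, ha, hmax⟩ := Set.exists_min_image _ id (hZ.inter_of_left (Set.Ioi w)) h
    exact Or.inl ⟨a, ha.1, ha.2, fun z hz hzw => hmax z ⟨hz, hzw⟩⟩
  · exact Or.inr fun z hz => not_lt.1 fun hzw => h ⟨z, hz, hzw⟩

/-- A finite set of reals that misses an interval misses an open neighbourhood of it. -/
lemma Set.Finite.exists_Ioo_disjoint {Z : Set ℝ} (hZ : Z.Finite) {u v : ℝ}
    (h : ∀ z ∈ Z, z ∉ Set.uIcc u v) :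
    ∃ a b, a < u ∧ a < v ∧ u < b ∧ v < b ∧ ∀ z ∈ Z, z ≤ a ∨ b ≤ z := by
  have hne : ∀ z ∈ Z, z < min u v ∨ max u v < z := fun z hz => by
    have := h z hz
    rw [Set.uIcc, Set.mem_Icc, not_and_or, not_le, not_le] at this
    exact this
  have hA : ∃ a < min u v, ∀ z ∈ Z, z < min u v → z ≤ a := by
    rcases hZ.exists_max_lt_or (min u v) with ⟨a, -, h1, h2⟩ | h1
    · exact ⟨a, h1, h2⟩
    · exact ⟨min u v - 1, by linarith, fun z hz hzu => absurd (h1 z hz) (not_le.2 hzu)⟩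
  have hB : ∃ b > max u v, ∀ z ∈ Z, max u v < z → b ≤ z := by
    rcases hZ.exists_min_gt_or (max u v) with ⟨a, -, h1, h2⟩ | h1
    · exact ⟨a, h1, h2⟩
    · exact ⟨max u v + 1, by linarith, fun z hz hzu => absurd (h1 z hz) (not_le.2 hzu)⟩
  obtain ⟨a, ha, ha'⟩ := hA
  obtain ⟨b, hb, hb'⟩ := hB
  exact ⟨a, b, ha.trans_le (min_le_left _ _), ha.trans_le (min_le_right _ _),
    (le_max_left _ _).trans_lt hb, (le_max_right _ _).trans_lt hb,
    fun z hz => (hne z hz).imp (ha' z hz) (hb' z hz)⟩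

/-! ### From the sign arrangement of a derivative to that of the polynomial -/

open Polynomial in
/-- The order isomorphism `θ` of `ℝ` carries the sign of `p` to the sign of `q`. -/
def MatchesSign (θ : ℝ ≃o ℝ) (p q : ℝ[X]) : Prop :=
  ∀ t, SignType.sign (p.eval t) = SignType.sign (q.eval (θ t))

open Polynomial in
lemma MatchesSign.symm {θ : ℝ ≃o ℝ} {p q : ℝ[X]} (h : MatchesSign θ p q) :
    MatchesSign θ.symm q p := fun t => by rw [h, θ.apply_symm_apply]

open Polynomial in
lemma MatchesSign.eval_eq_zero_iff {θ : ℝ ≃o ℝ} {p q : ℝ[X]} (h : MatchesSign θ p q) (t : ℝ) :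
    p.eval t = 0 ↔ q.eval (θ t) = 0 := by
  rw [← sign_eq_zero_iff, h t, sign_eq_zero_iff]

open Polynomial in
lemma MatchesSign.eq_zero {θ : ℝ ≃o ℝ} {p q : ℝ[X]} (h : MatchesSign θ p q) (hp : p = 0) :
    q = 0 := by
  refine Polynomial.funext fun t => ?_
  have := (h.eval_eq_zero_iff (θ.symm t)).1 (by simp [hp])
  simpa using this

open Polynomial in
/-- `θ` matches the signs of the derivatives of `P` and `Q`, and the signs of `P` and `Q` on a
finite set `Z` that contains the critical points of `P`. -/
structure MatchesOn (P Q : ℝ[X]) (θ : ℝ ≃o ℝ) (Z : Set ℝ) : Prop where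
  finite : Z.Finite
  critical : ∀ t, P.derivative.eval t = 0 → t ∈ Z
  derivative : MatchesSign θ P.derivative Q.derivative
  sign_eq : ∀ z ∈ Z, SignType.sign (P.eval z) = SignType.sign (Q.eval (θ z))

namespace MatchesOn
open Polynomial

variable {P Q : ℝ[X]} {θ : ℝ ≃o ℝ} {Z : Set ℝ}

lemma symm (h : MatchesOn P Q θ Z) : MatchesOn Q P θ.symm (θ '' Z) where
  finite := h.finite.image _
  critical t ht := ⟨θ.symm t, h.critical _ ((h.derivative.symm.eval_eq_zero_iff t).1 ht), by simp⟩
  derivative := h.derivative.symm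
  sign_eq := by
    rintro _ ⟨z, hz, rfl⟩
    rw [θ.symm_apply_apply, h.sign_eq z hz]

/-- No point of `θ '' Z` lies strictly between `θ w` and `s`. If `Z` has a next point `b` after `w`,
then `s = θ b` works, since `P` is strictly monotone on `[w, b]` and vanishes at `w`. Otherwise `Q`
has no critical point from `θ w` on, and `s` is taken far out. -/
lemma exists_right (h : MatchesOn P Q θ Z) {w : ℝ} (hw : w ∉ Z) (hPw : P.eval w = 0) :
    ∃ s, θ w ≤ s ∧ (∀ z ∈ Z, θ w ≤ θ z → s ≤ θ z) ∧
      SignType.sign (Q.eval s) = SignType.sign (P.derivative.eval w) := by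
  have hw0 : P.derivative.eval w ≠ 0 := fun h0 => hw (h.critical w h0)
  rcases h.finite.exists_min_gt_or w with ⟨b, hb, hwb, hmin⟩ | hmin
  · refine ⟨θ b, θ.monotone hwb.le, fun z hz hwz => θ.monotone (hmin z hz ?_), ?_⟩
    · exact lt_of_le_of_ne (θ.le_iff_le.1 hwz) fun e => hw (e ▸ hz)
    · rw [← h.sign_eq b hb]
      have := sign_eval_sub_eval hwb ⟨le_rfl, hwb.le⟩ hw0 fun x hx h0 =>
        absurd (hmin x (h.critical x h0) hx.1) (not_le.2 hx.2)
      rwa [hPw, sub_zero] at this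
  · obtain ⟨s, hs, hs'⟩ := exists_gt_sign_eq_sign_derivative (p := Q) (u := θ w) (fun x hx h0 => by
      have h1 := h.critical _ ((h.derivative.symm.eval_eq_zero_iff x).1 h0)
      have h2 := hmin _ h1
      have h3 : θ.symm x = w := le_antisymm h2 ((θ.le_symm_apply).2 hx)
      exact hw (h3 ▸ h1))
    refine ⟨s, hs.le, fun z hz hwz => absurd ?_ hw, ?_⟩
    · have : z = w := le_antisymm (hmin z hz) (θ.le_iff_le.1 hwz)
      exact this ▸ hz
    · rw [hs', h.derivative w]

lemma exists_left (h : MatchesOn P Q θ Z) {w : ℝ} (hw : w ∉ Z) (hPw : P.eval w = 0) :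
    ∃ s, s ≤ θ w ∧ (∀ z ∈ Z, θ z ≤ θ w → θ z ≤ s) ∧
      SignType.sign (Q.eval s) = -SignType.sign (P.derivative.eval w) := by
  have hw0 : P.derivative.eval w ≠ 0 := fun h0 => hw (h.critical w h0)
  rcases h.finite.exists_max_lt_or w with ⟨b, hb, hwb, hmin⟩ | hmin
  · refine ⟨θ b, θ.monotone hwb.le, fun z hz hwz => θ.monotone (hmin z hz ?_), ?_⟩
    · exact lt_of_le_of_ne (θ.le_iff_le.1 hwz) fun e => hw (e ▸ hz)
    · rw [← h.sign_eq b hb]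
      have := sign_eval_sub_eval hwb ⟨hwb.le, le_rfl⟩ hw0 fun x hx h0 =>
        absurd (hmin x (h.critical x h0) hx.2) (not_le.2 hx.1)
      rw [hPw, zero_sub, Left.sign_neg] at this
      rw [← this, neg_neg]
  · obtain ⟨s, hs, hs'⟩ := exists_lt_sign_eq_neg_sign_derivative (p := Q) (u := θ w)
      (fun x hx h0 => by
        have h1 := h.critical _ ((h.derivative.symm.eval_eq_zero_iff x).1 h0)
        have h2 := hmin _ h1
        have h3 : θ.symm x = w := le_antisymm ((θ.symm_apply_le).2 hx) h2
        exact hw (h3 ▸ h1))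
    refine ⟨s, hs.le, fun z hz hwz => absurd ?_ hw, ?_⟩
    · have : z = w := le_antisymm (θ.le_iff_le.1 hwz) (hmin z hz)
      exact this ▸ hz
    · rw [hs', h.derivative w]

/-- A root of `P` outside `Z` has a counterpart among the roots of `Q`. -/
lemma exists_root (h : MatchesOn P Q θ Z) {w : ℝ} (hw : w ∉ Z) (hPw : P.eval w = 0) :
    ∃ w', Q.eval w' = 0 ∧ ∀ z ∈ Z, θ z ∉ Set.uIcc (θ w) w' := by
  have hw0 : SignType.sign (P.derivative.eval w) ≠ 0 := by
    simpa using fun h0 => hw (h.critical w h0)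
  obtain ⟨r, hr1, hr2, hr3⟩ := h.exists_right hw hPw
  obtain ⟨l, hl1, hl2, hl3⟩ := h.exists_left hw hPw
  -- `Q` has opposite nonzero signs at the two ends of the gap of `θ '' Z` around `θ w`.
  obtain ⟨x, hx, hx0⟩ := exists_root_of_sign_eq_neg (p := Q) (u := l) (v := r) (by rw [hl3, hr3])
  rw [Set.uIcc_of_le (hl1.trans hr1)] at hx
  have hxl : l < x := lt_of_le_of_ne hx.1 fun e => hw0 (by
    rw [← e] at hx0
    rw [hx0, sign_zero] at hl3
    simpa using hl3.symm)
  have hxr : x < r := lt_of_le_of_ne hx.2 fun e => hw0 (by rw [← hr3, ← e, hx0, sign_zero])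
  refine ⟨x, hx0, fun z hz hzm => ?_⟩
  have hne : θ z ≠ θ w := fun e => hw (θ.injective e ▸ hz)
  rw [Set.mem_uIcc] at hzm
  rcases hzm with hzm | hzm
  · exact absurd (hr2 z hz hzm.1) (not_le.2 (hzm.2.trans_lt hxr))
  · exact absurd (hl2 z hz hzm.2) (not_le.2 (hxl.trans_le hzm.1))

/-- By Rolle, two distinct roots enclose a critical point, and critical points belong to `Z`. -/
lemma eq_of_root (h : MatchesOn P Q θ Z) {w v : ℝ} (hw : P.eval w = 0) (hv : P.eval v = 0)
    (hZ : ∀ z ∈ Z, z ∉ Set.uIcc w v) : w = v := by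
  by_contra hne
  wlog hlt : w < v generalizing w v
  · exact this hv hw (by rwa [Set.uIcc_comm]) (Ne.symm hne)
      (lt_of_le_of_ne (not_lt.1 hlt) (Ne.symm hne))
  obtain ⟨c, hc, hc0⟩ := exists_deriv_eq_zero (f := fun x => P.eval x) hlt
    P.continuous.continuousOn (hw.trans hv.symm)
  rw [Polynomial.deriv] at hc0
  exact hZ c (h.critical c hc0) (Set.mem_uIcc_of_le hc.1.le hc.2.le)

/-- Once roots go to roots, the sign at `t` is decided by the nearest point `s` to its left among
the roots of `P` and the points of `Z`: by the sign at `s` if that is nonzero, by the sign of the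
derivative if `s` is a root, and by the behaviour at `-∞` if there is no such point. -/
lemma matchesSign (h : MatchesOn P Q θ Z) (hroot : ∀ w, P.eval w = 0 → Q.eval (θ w) = 0) :
    MatchesSign θ P Q := by
  have hroot' : ∀ w, Q.eval (θ w) = 0 → P.eval w = 0 := by
    intro w hw
    by_cases hwZ : w ∈ Z
    · rw [← sign_eq_zero_iff, h.sign_eq w hwZ, hw, sign_zero]
    -- The inverse matching gives a root `r` of `P` in the same gap. Its image is a root of `Q` in
    -- the gap of `θ w`, and such a root is unique there by Rolle.
    obtain ⟨r, hr, hrZ⟩ := h.symm.exists_root (w := θ w) (fun ⟨z, hz, e⟩ =>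
      hwZ (θ.injective e ▸ hz)) hw
    have hrw : θ r = θ w := by
      refine h.symm.eq_of_root (hroot r hr) hw ?_
      rintro _ ⟨z, hz, rfl⟩ hzm
      refine hrZ _ ⟨z, hz, rfl⟩ ?_
      rw [θ.symm_apply_apply, θ.symm_apply_apply]
      rw [Set.mem_uIcc, θ.le_iff_le, θ.le_iff_le, θ.le_iff_le, θ.le_iff_le] at hzm
      rw [Set.mem_uIcc]
      exact hzm.symm
    rwa [← θ.injective hrw]
  intro t
  by_cases hPt : P.eval t = 0
  · rw [hPt, hroot t hPt]
  by_cases htZ : t ∈ Z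
  · exact h.sign_eq t htZ
  have hPt' : P.derivative.eval t ≠ 0 := fun h0 => htZ (h.critical t h0)
  have hQt' : Q.derivative.eval (θ t) ≠ 0 := fun h0 =>
    hPt' ((h.derivative.eval_eq_zero_iff t).2 h0)
  have hP0 : P ≠ 0 := by rintro rfl; simp at hPt
  have hfin : (Z ∪ {x | P.eval x = 0}).Finite :=
    h.finite.union (Polynomial.finite_setOfPred_isRoot hP0)
  have hno : ∀ s, (∀ z ∈ Z ∪ {x | P.eval x = 0}, z < t → z ≤ s) →
      (∀ x, s < x → x ≤ t → P.eval x ≠ 0) ∧ (∀ x, s < x → x ≤ t → P.derivative.eval x ≠ 0) ∧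
      (∀ x, θ s < x → x ≤ θ t → Q.eval x ≠ 0) ∧
        (∀ x, θ s < x → x ≤ θ t → Q.derivative.eval x ≠ 0) := by
    intro s hs
    have a1 : ∀ x, s < x → x ≤ t → P.eval x ≠ 0 := fun x hx hxt h0 => by
      rcases hxt.lt_or_eq with hxt | rfl
      · exact absurd (hs x (Or.inr h0) hxt) (not_le.2 hx)
      · exact hPt h0
    have a2 : ∀ x, s < x → x ≤ t → P.derivative.eval x ≠ 0 := fun x hx hxt h0 => by
      rcases hxt.lt_or_eq with hxt | rfl
      · exact absurd (hs x (Or.inl (h.critical x h0)) hxt) (not_le.2 hx)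
      · exact hPt' h0
    refine ⟨a1, a2, fun x hx hxt h0 => ?_, fun x hx hxt h0 => ?_⟩
    · exact a1 (θ.symm x) (θ.lt_symm_apply.2 hx) (θ.symm_apply_le.2 hxt)
        (hroot' _ (by rwa [θ.apply_symm_apply]))
    · exact a2 (θ.symm x) (θ.lt_symm_apply.2 hx) (θ.symm_apply_le.2 hxt)
        ((h.derivative.symm.eval_eq_zero_iff x).1 h0)
  rcases hfin.exists_max_lt_or t with ⟨s, hsZ, hst, hmax⟩ | hmin
  · obtain ⟨n1, n2, n3, n4⟩ := hno s hmax
    have hst' : θ s < θ t := θ.strictMono hst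
    by_cases hs0 : P.eval s = 0
    · have k1 := sign_eval_sub_eval hst ⟨hst.le, le_rfl⟩ hPt' fun x hx => n2 x hx.1 hx.2.le
      have k2 := sign_eval_sub_eval hst' ⟨hst'.le, le_rfl⟩ hQt' fun x hx => n4 x hx.1 hx.2.le
      rw [hs0, sub_zero] at k1
      rw [hroot s hs0, sub_zero] at k2
      rw [k1, k2, h.derivative t]
    · have hsZ' : s ∈ Z := hsZ.resolve_right hs0
      have k1 : SignType.sign (P.eval s) = SignType.sign (P.eval t) := by
        refine sign_eval_eq_of_forall_ne_zero fun x hx => ?_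
        rw [Set.uIcc_of_le hst.le] at hx
        rcases hx.1.eq_or_lt with rfl | hsx
        · exact hs0
        · exact n1 x hsx hx.2
      have k2 : SignType.sign (Q.eval (θ s)) = SignType.sign (Q.eval (θ t)) := by
        refine sign_eval_eq_of_forall_ne_zero fun x hx => ?_
        rw [Set.uIcc_of_le hst'.le] at hx
        rcases hx.1.eq_or_lt with rfl | hsx
        · exact fun h0 => hs0 (hroot' s h0)
        · exact n3 x hsx hx.2
      rw [← k1, ← k2, h.sign_eq s hsZ']
  · have hno' : ∀ x ≤ t, P.eval x ≠ 0 ∧ P.derivative.eval x ≠ 0 := fun x hx => by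
      have := hno (x - 1) fun z hz hzt => absurd (hmin z hz) (not_le.2 hzt)
      exact ⟨this.1 x (by linarith) hx, this.2.1 x (by linarith) hx⟩
    have hnoQ : ∀ x ≤ θ t, Q.eval x ≠ 0 ∧ Q.derivative.eval x ≠ 0 := fun x hx => by
      have k := hno' (θ.symm x) (θ.symm_apply_le.2 hx)
      exact ⟨fun h0 => k.1 (hroot' _ (by rwa [θ.apply_symm_apply])), fun h0 =>
        k.2 ((h.derivative.symm.eval_eq_zero_iff x).1 h0)⟩
    obtain ⟨s, hs, hs'⟩ := exists_lt_sign_eq_neg_sign_derivative fun x hx => (hno' x hx).2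
    obtain ⟨r, hr, hr'⟩ := exists_lt_sign_eq_neg_sign_derivative fun x hx => (hnoQ x hx).2
    have k1 : SignType.sign (P.eval s) = SignType.sign (P.eval t) :=
      sign_eval_eq_of_forall_ne_zero fun x hx =>
        (hno' x (by rw [Set.uIcc_of_le hs.le] at hx; exact hx.2)).1
    have k2 : SignType.sign (Q.eval r) = SignType.sign (Q.eval (θ t)) :=
      sign_eval_eq_of_forall_ne_zero fun x hx =>
        (hnoQ x (by rw [Set.uIcc_of_le hr.le] at hx; exact hx.2)).1
    rw [← k1, ← k2, hs', hr', h.derivative t]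

/-- Moving points only inside an interval free of `θ '' Z` preserves the matching of every pair of
polynomials the first of which has its roots in `Z`. -/
lemma _root_.MatchesSign.trans_bump {p q : ℝ[X]} {η : ℝ ≃o ℝ} {a b : ℝ}
    (h : MatchesSign θ p q) (hp : p = 0 ∨ ∀ t, p.eval t = 0 → t ∈ Z)
    (hη : ∀ x, x ≤ a ∨ b ≤ x → η x = x) (hZ : ∀ z ∈ Z, θ z ≤ a ∨ b ≤ θ z) :
    MatchesSign (θ.trans η) p q := by
  intro t
  rw [h t]
  change _ = SignType.sign (q.eval (η (θ t)))
  rcases hp with hp | hp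
  · rw [h.eq_zero hp]; simp
  by_cases ht : θ t ≤ a ∨ b ≤ θ t
  · rw [hη _ ht]
  push Not at ht
  have hab : a < b := ht.1.trans ht.2
  have e1 : a < η (θ t) := by rw [← hη a (Or.inl le_rfl)]; exact η.strictMono ht.1
  have e2 : η (θ t) < b := by rw [← hη b (Or.inr le_rfl)]; exact η.strictMono ht.2
  refine sign_eval_eq_of_forall_ne_zero fun x hx h0 => ?_
  have hxab : a < x ∧ x < b := by
    rw [Set.mem_uIcc] at hx
    rcases hx with hx | hx
    · exact ⟨ht.1.trans_le hx.1, hx.2.trans_lt e2⟩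
    · exact ⟨e1.trans_le hx.1, hx.2.trans_lt ht.2⟩
  have hz := hZ _ (hp _ ((h.symm.eval_eq_zero_iff x).1 h0))
  rw [θ.apply_symm_apply] at hz
  rcases hz with hz | hz
  · exact absurd hxab.1 (not_lt.2 hz)
  · exact absurd hxab.2 (not_lt.2 hz)

/-- Induction on the number of roots of `P` that `θ` does not send to roots of `Q`. For such a root
`w`, composing `θ` with a bump inside a gap of `θ '' Z` moves `θ w` to a root of `Q`. The gap
contains the image of no other root of `P`, so no good root is spoiled, and the other matchings
survive because nothing in `θ '' Z` moves. -/
theorem exists_matchesSign {ι : Type*} {p q : ι → ℝ[X]}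
    (hp : ∀ i, p i = 0 ∨ ∀ t, (p i).eval t = 0 → t ∈ Z) (h : MatchesOn P Q θ Z) (hP : P ≠ 0)
    (hpq : ∀ i, MatchesSign θ (p i) (q i)) :
    ∃ θ' : ℝ ≃o ℝ, (∀ i, MatchesSign θ' (p i) (q i)) ∧ MatchesSign θ' P Q := by
  have hfin : ∀ θ : ℝ ≃o ℝ, {w | P.eval w = 0 ∧ Q.eval (θ w) ≠ 0}.Finite := fun θ =>
    (Polynomial.finite_setOfPred_isRoot hP).subset fun w hw => hw.1
  induction hn : {w | P.eval w = 0 ∧ Q.eval (θ w) ≠ 0}.ncard using Nat.strong_induction_on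
    generalizing θ with
  | _ n ih =>
  by_cases hbad : ∀ w, P.eval w = 0 → Q.eval (θ w) = 0
  · exact ⟨θ, hpq, h.matchesSign hbad⟩
  push Not at hbad
  obtain ⟨w, hw, hQw⟩ := hbad
  have hwZ : w ∉ Z := fun hz => hQw (by
    rw [← sign_eq_zero_iff, ← h.sign_eq w hz, hw, sign_zero])
  obtain ⟨w', hw', hZw⟩ := h.exists_root hwZ hw
  obtain ⟨a, b, hau, hav, hub, hvb, hab⟩ := (h.finite.image θ).exists_Ioo_disjoint
    (u := θ w) (v := w') (by rintro _ ⟨z, hz, rfl⟩; exact hZw z hz)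
  have hab' : ∀ z ∈ Z, θ z ≤ a ∨ b ≤ θ z := fun z hz => hab _ ⟨z, hz, rfl⟩
  obtain ⟨η, hη, hηfix⟩ := exists_orderIso_bump hau hav hub hvb
  have hnew : MatchesOn P Q (θ.trans η) Z :=
    { finite := h.finite
      critical := h.critical
      derivative := h.derivative.trans_bump (Or.inr h.critical) hηfix hab'
      sign_eq := fun z hz => by
        change _ = SignType.sign (Q.eval (η (θ z)))
        rw [hηfix _ (hab' z hz), h.sign_eq z hz] }
  refine ih _ ?_ hnew (fun i => (hpq i).trans_bump (hp i) hηfix hab') rfl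
  rw [← hn]
  -- The new set of bad roots is contained in the old one and omits `w`.
  refine Set.ncard_lt_ncard ?_ (hfin θ)
  rw [Set.ssubset_iff_of_subset]
  · refine ⟨w, ⟨hw, hQw⟩, fun hmem => hmem.2 ?_⟩
    change Q.eval (η (θ w)) = 0
    rw [hη, hw']
  · rintro x ⟨hx, hQx⟩
    refine ⟨hx, ?_⟩
    change Q.eval (η (θ x)) ≠ 0 at hQx
    by_cases hxab : θ x ≤ a ∨ b ≤ θ x
    · rwa [hηfix _ hxab] at hQx
    · push Not at hxab
      have hxw : x = w := by
        refine h.eq_of_root hx hw fun z hz hzm => ?_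
        rw [Set.mem_uIcc, ← θ.le_iff_le (x := x), ← θ.le_iff_le (y := w), ← θ.le_iff_le (x := w),
          ← θ.le_iff_le (y := x)] at hzm
        rcases hab' z hz with hz' | hz' <;> rcases hzm with hzm | hzm <;> linarith
      rw [hxw, hη] at hQx
      exact absurd hw' hQx

end MatchesOn

/-! ### Quantifier elimination by the Cohen–Hörmander method -/

section RealQuantifierElimination
open Polynomial

variable {R : Type*} [CommRing R]

/-- Pseudo-division by a polynomial of degree at most `j`. -/
lemma Polynomial.exists_pseudo_division {g : R[X]} {j : ℕ} (hg : g.natDegree ≤ j) (hj : 1 ≤ j)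
    (P : R[X]) : ∃ (k : ℕ) (q r : R[X]), C (g.coeff j) ^ k * P = q * g + r ∧ r.natDegree < j := by
  induction hm : P.natDegree using Nat.strong_induction_on generalizing P with
  | _ m ih =>
  by_cases hmj : m < j
  · exact ⟨0, 0, P, by simp, by omega⟩
  push Not at hmj
  set P₁ := C (g.coeff j) * P - C (P.coeff m) * X ^ (m - j) * g with hP₁
  have hdeg : P₁.natDegree < m := by
    have hle : P₁.natDegree ≤ m := by
      refine (natDegree_sub_le _ _).trans (max_le ?_ ?_)
      · exact (natDegree_C_mul_le _ _).trans hm.le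
      · rw [mul_assoc]
        refine (natDegree_C_mul_le _ _).trans (natDegree_mul_le.trans ?_)
        have := natDegree_X_pow_le (R := R) (m - j)
        omega
    refine lt_of_le_of_ne hle fun heq => ?_
    -- The terms of degree `m` cancel, even when `g.coeff j` is zero.
    have hc : P₁.coeff m = 0 := by
      have : (X ^ (m - j) * g).coeff m = g.coeff j := by
        conv_lhs => rw [show m = j + (m - j) by omega]
        rw [show j + (m - j) - j = m - j by omega, coeff_X_pow_mul]
      rw [hP₁, coeff_sub, coeff_C_mul, mul_assoc, coeff_C_mul, this]
      ring
    have h0 : P₁ = 0 := by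
      rw [← leadingCoeff_eq_zero, leadingCoeff, heq, hc]
    rw [h0, natDegree_zero] at heq
    omega
  obtain ⟨k, q, r, h, hr⟩ := ih _ hdeg P₁ rfl
  refine ⟨k + 1, C (g.coeff j) ^ k * C (P.coeff m) * X ^ (m - j) + q, r, ?_, hr⟩
  have : C (g.coeff j) ^ (k + 1) * P =
      C (g.coeff j) ^ k * (C (P.coeff m) * X ^ (m - j) * g) + C (g.coeff j) ^ k * P₁ := by
    rw [hP₁]; ring
  rw [this, h]; ring

/-- A polynomial of degree less than `j` that computes, up to a power of the `j`th coefficient of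
`f`, the values of `P` at the roots of each specialization of `f` of degree at most `j`. -/
lemma Polynomial.exists_remainder (P f : R[X]) (j : ℕ) : ∃ r : R[X], 1 ≤ j → r.natDegree < j ∧
    ∃ k : ℕ, ∀ φ : R →+* ℝ, (f.map φ).natDegree ≤ j → ∀ t, (f.map φ).eval t = 0 →
      φ (f.coeff j) ^ k * (P.map φ).eval t = (r.map φ).eval t := by
  by_cases hj : 1 ≤ j
  swap
  · exact ⟨0, fun h => absurd h hj⟩
  -- `g` is `f` truncated to degree at most `j`; it has the same image as `f` under every
  -- specialization for which that image has degree at most `j`.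
  set g : R[X] := ∑ i ∈ Finset.range (j + 1), monomial i (f.coeff i) with hg
  have hgd : g.natDegree ≤ j := natDegree_sum_le_of_forall_le _ _ fun i hi =>
    (natDegree_monomial_le _).trans (Nat.lt_succ_iff.1 (Finset.mem_range.1 hi))
  have hgc : g.coeff j = f.coeff j := by
    simp [hg, coeff_monomial]
  obtain ⟨k, q, r, h, hr⟩ := exists_pseudo_division hgd hj P
  refine ⟨r, fun _ => ⟨hr, k, fun φ hφ t ht => ?_⟩⟩
  have hgφ : g.map φ = f.map φ := by
    rw [as_sum_range' (f.map φ) (j + 1) (Nat.lt_succ_iff.2 hφ), hg, Polynomial.map_sum]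
    simp
  have := congrArg (fun p => (p.map φ).eval t) h
  simpa [hgφ, ht, hgc] using this

/-- For a finite set of polynomials over `R`, the arrangement on the real line of the signs of their
specializations along `R →+* ℝ` is determined by the signs of finitely many elements of `R`. -/
def SignsDetermined (F : Finset R[X]) : Prop :=
  ∃ S : Finset R, ∀ φ ψ : R →+* ℝ, (∀ a ∈ S, SignType.sign (φ a) = SignType.sign (ψ a)) →
    ∃ θ : ℝ ≃o ℝ, ∀ p ∈ F, MatchesSign θ (p.map φ) (p.map ψ)

/-- The inductive step when the leading coefficient of `P` survives. At a root of a specialized `f`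
of true degree `j`, the value of `P` times a power of the leading coefficient of `f` is the value of
`rem f j`. Hence matching the coefficients and remainders already matches the signs of `P` at all
roots of the nonzero specializations of `F`, critical points of `P` included, which is what
`MatchesOn` asks. -/
lemma MatchesSign.extend_of_remainders {F : Finset R[X]} {P : R[X]} {d : ℕ}
    (hF : ∀ f ∈ F, f.natDegree ≤ d + 1) (hP : P.natDegree = d + 1) (hP' : P.derivative ∈ F)
    (rem : R[X] → ℕ → R[X])
    (hrem : ∀ f j, 1 ≤ j → (rem f j).natDegree < j ∧
      ∃ k : ℕ, ∀ φ : R →+* ℝ, (f.map φ).natDegree ≤ j → ∀ t, (f.map φ).eval t = 0 →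
        φ (f.coeff j) ^ k * (P.map φ).eval t = ((rem f j).map φ).eval t)
    {φ ψ : R →+* ℝ} (θ : ℝ ≃o ℝ)
    (hlc : φ P.leadingCoeff ≠ 0)
    (hcoeff : ∀ f ∈ F, ∀ i, SignType.sign (φ (f.coeff i)) = SignType.sign (ψ (f.coeff i)))
    (hθ : ∀ f ∈ F, MatchesSign θ (f.map φ) (f.map ψ))
    (hθr : ∀ f ∈ F, ∀ j, 1 ≤ j → j ≤ d + 1 →
      MatchesSign θ ((rem f j).map φ) ((rem f j).map ψ)) :
    ∃ θ' : ℝ ≃o ℝ, (∀ f ∈ F, MatchesSign θ' (f.map φ) (f.map ψ)) ∧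
      MatchesSign θ' (P.map φ) (P.map ψ) := by
  have hPc : (P.map φ).coeff (d + 1) ≠ 0 := by rwa [coeff_map, ← hP]
  have hPφ : P.map φ ≠ 0 := fun h => hPc (by simp [h])
  have hPφ' : P.derivative.map φ ≠ 0 := fun h => by
    have : (P.derivative.map φ).coeff d = 0 := by simp [h]
    rw [← derivative_map, coeff_derivative] at this
    exact mul_ne_zero hPc (by positivity) this
  let Z : Set ℝ := ⋃ f ∈ F, {t | f.map φ ≠ 0 ∧ (f.map φ).eval t = 0}
  have hZ : ∀ f ∈ F, f.map φ = 0 ∨ ∀ t, (f.map φ).eval t = 0 → t ∈ Z := by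
    intro f hf
    by_cases h0 : f.map φ = 0
    · exact Or.inl h0
    · exact Or.inr fun t ht => Set.mem_biUnion (x := f) hf ⟨h0, ht⟩
  have hM : MatchesOn (P.map φ) (P.map ψ) θ Z :=
    { finite := by
        refine F.finite_toSet.biUnion fun f _ => ?_
        by_cases h0 : f.map φ = 0
        · simp [h0]
        · exact (Polynomial.finite_setOfPred_isRoot h0).subset fun t ht => ht.2
      critical := by
        rw [derivative_map]
        exact (hZ _ hP').resolve_left hPφ'
      derivative := by
        rw [derivative_map, derivative_map]
        exact hθ _ hP'
      sign_eq := by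
        intro t ht
        obtain ⟨f, hf, h0, ht⟩ := Set.mem_iUnion₂.1 ht
        set j := (f.map φ).natDegree with hj
        -- A nonzero polynomial with a root is not constant.
        have hj1 : 1 ≤ j := by
          by_contra hlt
          rw [eq_C_of_natDegree_eq_zero (p := f.map φ) (by omega), eval_C] at ht
          exact h0 (by rw [eq_C_of_natDegree_eq_zero (p := f.map φ) (by omega), ht, C_0])
        have hjd : j ≤ d + 1 := natDegree_map_le.trans (hF f hf)
        have hψ : (f.map ψ).natDegree ≤ j := by
          rw [natDegree_le_iff_coeff_eq_zero]
          intro i hi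
          have h1 : φ (f.coeff i) = 0 := by
            rw [← coeff_map]; exact coeff_eq_zero_of_natDegree_lt hi
          rw [coeff_map, ← sign_eq_zero_iff, ← hcoeff f hf i, h1, sign_zero]
        have hψt : (f.map ψ).eval (θ t) = 0 := ((hθ f hf).eval_eq_zero_iff t).1 ht
        obtain ⟨-, k, hk⟩ := hrem f j hj1
        have e1 := congrArg SignType.sign (hk φ le_rfl t ht)
        have e2 := congrArg SignType.sign (hk ψ hψ (θ t) hψt)
        rw [← hθr f hf j hj1 hjd t, ← e1, sign_mul, sign_mul, sign_pow, sign_pow,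
          ← hcoeff f hf j] at e2
        have hne : SignType.sign (φ (f.coeff j)) ^ k ≠ 0 := by
          refine pow_ne_zero _ ?_
          rw [sign_ne_zero, ← coeff_map]
          exact leadingCoeff_ne_zero.2 h0
        exact (mul_left_cancel₀ hne e2).symm }
  obtain ⟨θ', h1, h2⟩ := hM.exists_matchesSign (p := fun f : F => f.1.map φ)
    (q := fun f : F => f.1.map ψ) (fun f => hZ f.1 f.2) hPφ fun f => hθ f.1 f.2
  exact ⟨θ', fun f hf => h1 ⟨f, hf⟩, h2⟩

lemma SignsDetermined.of_natDegree_le_zero {F : Finset R[X]} (h : ∀ f ∈ F, f.natDegree ≤ 0) :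
    SignsDetermined F := by
  classical
  refine ⟨F.image fun f => f.coeff 0, fun φ ψ hS => ⟨OrderIso.refl ℝ, fun p hp t => ?_⟩⟩
  have := hS _ (Finset.mem_image_of_mem _ hp)
  rw [eq_C_of_natDegree_le_zero (h p hp)]
  simpa using this

/-- Quantifier elimination for the reals, in the form given to it by Cohen and Hörmander. -/
theorem signsDetermined (F : Finset R[X]) : SignsDetermined F := by
  classical
  -- Lexicographic induction on a bound for the degrees and the number of polynomials that attain
  -- it.
  suffices H : ∀ d (F : Finset R[X]), (∀ f ∈ F, f.natDegree ≤ d) → SignsDetermined F from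
    H (F.sup natDegree) F fun f hf => Finset.le_sup (f := natDegree) hf
  intro d
  induction d with
  | zero => exact fun F hF => SignsDetermined.of_natDegree_le_zero hF
  | succ d ihd =>
  suffices H : ∀ n (F : Finset R[X]), (∀ f ∈ F, f.natDegree ≤ d + 1) →
      (F.filter fun f => f.natDegree = d + 1).card = n → SignsDetermined F from
    fun F hF => H _ F hF rfl
  intro n
  induction n with
  | zero =>
    intro F hF hn
    refine ihd F fun f hf => ?_
    rw [Finset.card_eq_zero, Finset.filter_eq_empty_iff] at hn
    have := hF f hf
    have := hn hf
    omega
  | succ n ihn =>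
  intro F hF hn
  obtain ⟨P, hPF⟩ : (F.filter fun f => f.natDegree = d + 1).Nonempty :=
    Finset.card_pos.1 (by omega)
  have hPmem := (Finset.mem_filter.1 hPF).1
  have hPdeg := (Finset.mem_filter.1 hPF).2
  choose rem hrem using fun f j => Polynomial.exists_remainder P f j
  set A := insert P.derivative (F.erase P) with hA
  have hP'deg : P.derivative.natDegree ≤ d := by
    have := natDegree_derivative_le P; omega
  have hAdeg : ∀ f ∈ A, f.natDegree ≤ d + 1 := by
    intro f hf
    rcases Finset.mem_insert.1 hf with rfl | hf
    · omega
    · exact hF f (Finset.mem_of_mem_erase hf)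
  -- Everything that replaces `P`: its derivative, `P` without leading term (in case the leading
  -- coefficient specializes to zero), all coefficients as constants, and the remainders of `P`. All
  -- have degree at most `d`, so one polynomial of top degree is lost.
  set L : Finset R[X] := {P.derivative, P.eraseLead} ∪
    ((insert P A).biUnion fun f => (Finset.range (d + 2)).image fun i => C (f.coeff i)) ∪
    (A.biUnion fun f => (Finset.Icc 1 (d + 1)).image (rem f)) with hL
  have hLdeg : ∀ f ∈ L, f.natDegree ≤ d := by
    intro f hf
    simp only [hL, Finset.mem_union, Finset.mem_biUnion, Finset.mem_image, Finset.mem_insert,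
      Finset.mem_singleton, Finset.mem_Icc] at hf
    rcases hf with ((rfl | rfl) | ⟨g, -, i, -, rfl⟩) | ⟨g, -, j, ⟨hj1, hj2⟩, rfl⟩
    · exact hP'deg
    · have := eraseLead_natDegree_le P; omega
    · simp
    · have := (hrem g j hj1).1; omega
  obtain ⟨S, hS⟩ := ihn (F.erase P ∪ L) (by
      intro f hf
      rcases Finset.mem_union.1 hf with hf | hf
      · exact hF f (Finset.mem_of_mem_erase hf)
      · exact (hLdeg f hf).trans (Nat.le_succ d)) (by
      have : (F.erase P ∪ L).filter (fun f => f.natDegree = d + 1) =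
          (F.filter fun f => f.natDegree = d + 1).erase P := by
        rw [Finset.filter_union, Finset.filter_false_of_mem (s := L) (fun f hf h => by
          have := hLdeg f hf; omega), Finset.union_empty]
        ext f
        simp only [Finset.mem_filter, Finset.mem_erase]
        tauto
      rw [this, Finset.card_erase_of_mem hPF, hn, Nat.add_sub_cancel])
  refine ⟨S, fun φ ψ hφψ => ?_⟩
  obtain ⟨θ, hθ⟩ := hS φ ψ hφψ
  have hθL : ∀ f ∈ L, MatchesSign θ (f.map φ) (f.map ψ) := fun f hf =>
    hθ f (Finset.mem_union_right _ hf)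
  have hcoeff : ∀ f ∈ insert P A, ∀ i,
      SignType.sign (φ (f.coeff i)) = SignType.sign (ψ (f.coeff i)) := by
    intro f hf i
    by_cases hi : i < d + 2
    · have hm : C (f.coeff i) ∈ L := by
        refine Finset.mem_union_left _ (Finset.mem_union_right _ (Finset.mem_biUnion.2 ⟨f, hf, ?_⟩))
        exact Finset.mem_image_of_mem _ (Finset.mem_range.2 hi)
      simpa using hθL _ hm 0
    · have : f.coeff i = 0 := by
        refine coeff_eq_zero_of_natDegree_lt ?_
        rcases Finset.mem_insert.1 hf with rfl | hf
        · omega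
        · have := hAdeg f hf; omega
      simp [this]
  have hfinish : ∀ θ' : ℝ ≃o ℝ, (∀ f ∈ F.erase P, MatchesSign θ' (f.map φ) (f.map ψ)) →
      MatchesSign θ' (P.map φ) (P.map ψ) →
      ∀ f ∈ F, MatchesSign θ' (f.map φ) (f.map ψ) := by
    intro θ' h1 h2 f hf
    by_cases hfP : f = P
    · rwa [hfP]
    · exact h1 f (Finset.mem_erase.2 ⟨hfP, hf⟩)
  -- If the leading coefficient vanishes at `φ`, it does at `ψ`, and `P` specializes to
  -- `P.eraseLead`, which is already matched.
  by_cases hlc : φ P.leadingCoeff = 0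
  · have hlc' : ψ P.leadingCoeff = 0 := by
      rw [← sign_eq_zero_iff, leadingCoeff, ← hcoeff P (Finset.mem_insert_self _ _), ← leadingCoeff,
        hlc, sign_zero]
    have herase : ∀ χ : R →+* ℝ, χ P.leadingCoeff = 0 → P.map χ = P.eraseLead.map χ := by
      intro χ hχ
      conv_lhs => rw [← eraseLead_add_monomial_natDegree_leadingCoeff P]
      rw [Polynomial.map_add, map_monomial, hχ, monomial_zero_right, add_zero]
    refine ⟨θ, hfinish θ (fun f hf => hθ f (Finset.mem_union_left _ hf)) ?_⟩
    rw [herase φ hlc, herase ψ hlc']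
    exact hθL _ (by simp [hL])
  · obtain ⟨θ', h1, h2⟩ := MatchesSign.extend_of_remainders hAdeg hPdeg
      (Finset.mem_insert_self _ _) rem hrem θ hlc
      (fun f hf => hcoeff f (Finset.mem_insert_of_mem hf))
      (fun f hf => by
        rcases Finset.mem_insert.1 hf with rfl | hf
        · exact hθL _ (by simp [hL])
        · exact hθ f (Finset.mem_union_left _ hf))
      (fun f hf j hj1 hj2 => hθL _ (Finset.mem_union_right _ (Finset.mem_biUnion.2
        ⟨f, hf, Finset.mem_image_of_mem _ (Finset.mem_Icc.2 ⟨hj1, hj2⟩)⟩)))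
    exact ⟨θ', hfinish θ' (fun f hf => h1 f (Finset.mem_insert_of_mem hf)) h2⟩

end RealQuantifierElimination

/-! ### Semi-algebraic predicates and their closure under quantifiers -/

section SemialgebraicPredicates

variable {ι κ : Type}

/-- A function of real variables given by a polynomial. -/
def IsPolyMap (f : (ι → ℝ) → ℝ) : Prop :=
  ∃ p : MvPolynomial ι ℝ, ∀ x, f x = MvPolynomial.eval x p

namespace IsPolyMap

variable {f g : (ι → ℝ) → ℝ}

lemma coord (i : ι) : IsPolyMap fun x : ι → ℝ => x i := ⟨MvPolynomial.X i, by simp⟩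

lemma const (c : ℝ) : IsPolyMap fun _ : ι → ℝ => c := ⟨MvPolynomial.C c, by simp⟩

lemma add (hf : IsPolyMap f) (hg : IsPolyMap g) : IsPolyMap fun x => f x + g x := by
  obtain ⟨p, hp⟩ := hf
  obtain ⟨q, hq⟩ := hg
  exact ⟨p + q, by simp [hp, hq]⟩

lemma sub (hf : IsPolyMap f) (hg : IsPolyMap g) : IsPolyMap fun x => f x - g x := by
  obtain ⟨p, hp⟩ := hf
  obtain ⟨q, hq⟩ := hg
  exact ⟨p - q, by simp [hp, hq]⟩

lemma mul (hf : IsPolyMap f) (hg : IsPolyMap g) : IsPolyMap fun x => f x * g x := by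
  obtain ⟨p, hp⟩ := hf
  obtain ⟨q, hq⟩ := hg
  exact ⟨p * q, by simp [hp, hq]⟩

lemma pow (hf : IsPolyMap f) (k : ℕ) : IsPolyMap fun x => f x ^ k := by
  obtain ⟨p, hp⟩ := hf
  exact ⟨p ^ k, by simp [hp]⟩

lemma sum {α : Type*} {s : Finset α} {f : α → (ι → ℝ) → ℝ} (hf : ∀ i, IsPolyMap (f i)) :
    IsPolyMap fun x => ∑ i ∈ s, f i x := by
  choose p hp using hf
  exact ⟨∑ i ∈ s, p i, by simp [hp]⟩

lemma eval_comp {g : (κ → ℝ) → ι → ℝ} (hg : ∀ i, IsPolyMap fun x => g x i)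
    (p : MvPolynomial ι ℝ) : IsPolyMap fun x => MvPolynomial.eval (g x) p := by
  choose q hq using hg
  refine ⟨MvPolynomial.bind₁ q p, fun x => ?_⟩
  induction p using MvPolynomial.induction_on with
  | C a => simp
  | add p q h1 h2 => simp only [map_add, h1, h2]
  | mul_X p i h => simp only [map_mul, h, MvPolynomial.bind₁_X_right, MvPolynomial.eval_X, ← hq]

end IsPolyMap

/-- A predicate of real variables whose truth is determined by the signs of finitely many
polynomials. -/
def SemialgPred (P : (ι → ℝ) → Prop) : Prop :=
  ∃ F : Finset (MvPolynomial ι ℝ), ∀ x y,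
    (∀ p ∈ F, SignType.sign (MvPolynomial.eval x p) = SignType.sign (MvPolynomial.eval y p)) →
      P x → P y

namespace SemialgPred

variable {P Q : (ι → ℝ) → Prop}

lemma not (hP : SemialgPred P) : SemialgPred fun x => ¬ P x := by
  obtain ⟨F, hF⟩ := hP
  exact ⟨F, fun x y h hx hy => hx (hF y x (fun p hp => (h p hp).symm) hy)⟩

lemma and (hP : SemialgPred P) (hQ : SemialgPred Q) : SemialgPred fun x => P x ∧ Q x := by
  classical
  obtain ⟨F, hF⟩ := hP
  obtain ⟨G, hG⟩ := hQ
  exact ⟨F ∪ G, fun x y h hx => ⟨hF x y (fun p hp => h p (Finset.mem_union_left _ hp)) hx.1,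
    hG x y (fun p hp => h p (Finset.mem_union_right _ hp)) hx.2⟩⟩

lemma congr (hP : SemialgPred P) (h : ∀ x, Q x ↔ P x) : SemialgPred Q := by
  rwa [show Q = P from funext fun x => propext (h x)]

lemma imp (hP : SemialgPred P) (hQ : SemialgPred Q) : SemialgPred fun x => P x → Q x :=
  (hP.and hQ.not).not.congr fun x => by tauto

lemma sign_const_pred {f : (ι → ℝ) → ℝ} (hf : IsPolyMap f) (T : SignType → Prop) :
    SemialgPred fun x => T (SignType.sign (f x)) := by
  obtain ⟨p, hp⟩ := hf
  refine ⟨{p}, fun x y h hx => ?_⟩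
  have := h p (Finset.mem_singleton_self p)
  rw [← hp, ← hp] at this
  change T _
  rwa [← this]

variable {f g : (ι → ℝ) → ℝ}

lemma lt (hf : IsPolyMap f) (hg : IsPolyMap g) : SemialgPred fun x => f x < g x :=
  (sign_const_pred (hg.sub hf) (· = 1)).congr fun x => by rw [sign_eq_one_iff, sub_pos]

lemma le (hf : IsPolyMap f) (hg : IsPolyMap g) : SemialgPred fun x => f x ≤ g x :=
  (lt hg hf).not.congr fun _ => not_lt.symm

lemma eq (hf : IsPolyMap f) (hg : IsPolyMap g) : SemialgPred fun x => f x = g x :=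
  (sign_const_pred (hg.sub hf) (· = 0)).congr fun x => by
    rw [sign_eq_zero_iff, sub_eq_zero, eq_comm]

lemma comp {P : (ι → ℝ) → Prop} (hP : SemialgPred P) {g : (κ → ℝ) → ι → ℝ}
    (hg : ∀ i, IsPolyMap fun x => g x i) : SemialgPred fun x => P (g x) := by
  classical
  obtain ⟨F, hF⟩ := hP
  choose q hq using IsPolyMap.eval_comp hg
  refine ⟨F.image q, fun x y h hx => hF _ _ (fun p hp => ?_) hx⟩
  refine (congrArg _ (hq p x)).trans (Eq.trans ?_ (congrArg _ (hq p y)).symm)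
  exact h _ (Finset.mem_image_of_mem _ hp)

/-- The Tarski–Seidenberg principle. -/
lemma exists_real {P : (ι → ℝ) → ℝ → Prop}
    (hP : SemialgPred fun z : Option ι → ℝ => P (fun i => z (some i)) (z none)) :
    SemialgPred fun x => ∃ t, P x t := by
  classical
  obtain ⟨F, hF⟩ := hP
  obtain ⟨S, hS⟩ := signsDetermined (F.image (MvPolynomial.optionEquivLeft ℝ ι))
  refine ⟨S, fun x y h => ?_⟩
  rintro ⟨t, ht⟩
  obtain ⟨θ, hθ⟩ := hS (MvPolynomial.eval x) (MvPolynomial.eval y) h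
  -- The matching bijection carries a witness over `x` to a witness over `y`.
  refine ⟨θ t, hF (fun o => o.elim t x) (fun o => o.elim (θ t) y) (fun p hp => ?_) ht⟩
  rw [MvPolynomial.optionEquivLeft_elim_eval, MvPolynomial.optionEquivLeft_elim_eval]
  exact hθ _ (Finset.mem_image_of_mem _ hp) t

lemma forall_real {P : (ι → ℝ) → ℝ → Prop}
    (hP : SemialgPred fun z : Option ι → ℝ => P (fun i => z (some i)) (z none)) :
    SemialgPred fun x => ∀ t, P x t :=
  (exists_real (P := fun x t => ¬ P x t) hP.not).not.congr fun x => by push Not; rfl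

lemma exists_vec {n : ℕ} {P : (ι → ℝ) → (Fin n → ℝ) → Prop}
    (hP : SemialgPred fun z : ι ⊕ Fin n → ℝ => P (fun i => z (Sum.inl i)) fun j => z (Sum.inr j)) :
    SemialgPred fun x => ∃ y, P x y := by
  induction n generalizing ι with
  | zero =>
    have h := hP.comp (g := fun x : ι → ℝ => Sum.elim x Fin.elim0) (by
      rintro (i | i)
      · exact IsPolyMap.coord i
      · exact i.elim0)
    refine h.congr fun x => ⟨?_, fun hx => ⟨_, hx⟩⟩
    rintro ⟨y, hy⟩
    convert! hy using 1
  | succ n ih =>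
    have h := hP.comp (g := fun w : Option ι ⊕ Fin n → ℝ => Sum.elim (fun i => w (Sum.inl (some i)))
      (Fin.cons (w (Sum.inl none)) fun j => w (Sum.inr j))) (by
      rintro (i | i)
      · exact IsPolyMap.coord _
      · refine Fin.cases ?_ (fun j => ?_) i
        · exact IsPolyMap.coord _
        · exact IsPolyMap.coord _)
    have h2 := exists_real (P := fun x t => ∃ y : Fin n → ℝ, P x (Fin.cons t y))
      (ih (P := fun z y => P (fun i => z (some i)) (Fin.cons (z none) y)) h)
    refine h2.congr fun x => ⟨?_, ?_⟩
    · rintro ⟨y, hy⟩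
      exact ⟨y 0, Fin.tail y, by rwa [Fin.cons_self_tail]⟩
    · rintro ⟨t, y, hy⟩
      exact ⟨_, hy⟩

lemma forall_vec {n : ℕ} {P : (ι → ℝ) → (Fin n → ℝ) → Prop}
    (hP : SemialgPred fun z : ι ⊕ Fin n → ℝ => P (fun i => z (Sum.inl i)) fun j => z (Sum.inr j)) :
    SemialgPred fun x => ∀ y, P x y :=
  (exists_vec (P := fun x y => ¬ P x y) hP.not).not.congr fun x => by push Not; rfl

end SemialgPred

/-- A semi-algebraic set is a finite union of sets described by sign conditions on the polynomials
of one finite family. -/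
lemma isSemialgebraic_iff {k : ℕ} {A : Set (Fin k → ℝ)} :
    IsSemialgebraic A ↔ SemialgPred (· ∈ A) := by
  classical
  constructor
  · rintro ⟨r, F, G, rfl⟩
    refine ⟨Finset.univ.biUnion fun i => F i ∪ G i, fun x y h hx => ?_⟩
    obtain ⟨i, h1, h2⟩ := Set.mem_iUnion.1 hx
    have h' : ∀ p ∈ F i ∪ G i, SignType.sign (MvPolynomial.eval x p) =
        SignType.sign (MvPolynomial.eval y p) := fun p hp =>
      h p (Finset.mem_biUnion.2 ⟨i, Finset.mem_univ _, hp⟩)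
    refine Set.mem_iUnion.2 ⟨i, fun p hp => ?_, fun p hp => ?_⟩
    · rw [← sign_eq_one_iff, ← h' p (Finset.mem_union_left _ hp), sign_eq_one_iff]
      exact h1 p hp
    · rw [← sign_eq_zero_iff, ← h' p (Finset.mem_union_right _ hp), sign_eq_zero_iff]
      exact h2 p hp
  · rintro ⟨F, hF⟩
    -- The sign vectors attained on `A`. They are finite in number, and `A` is the union of the sets
    -- on which they are attained.
    let T := {σ : F → SignType // ∃ x ∈ A, ∀ p : F,
      SignType.sign (MvPolynomial.eval x p.1) = σ p}
    let e := Fintype.equivFin T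
    refine ⟨Fintype.card T, fun i =>
      (Finset.univ.filter fun p : F => (e.symm i).1 p = 1).image Subtype.val ∪
        (Finset.univ.filter fun p : F => (e.symm i).1 p = -1).image fun p => -p.1, fun i =>
      (Finset.univ.filter fun p : F => (e.symm i).1 p = 0).image Subtype.val, ?_⟩
    have key : ∀ (σ : F → SignType) (x : Fin k → ℝ),
        ((∀ f ∈ (Finset.univ.filter fun p : F => σ p = 1).image Subtype.val ∪
          (Finset.univ.filter fun p : F => σ p = -1).image fun p => -p.1,
            0 < MvPolynomial.eval x f) ∧
          ∀ g ∈ (Finset.univ.filter fun p : F => σ p = 0).image Subtype.val,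
            MvPolynomial.eval x g = 0) ↔
        ∀ p : F, SignType.sign (MvPolynomial.eval x p.1) = σ p := by
      intro σ x
      simp only [Finset.mem_union, Finset.mem_image, Finset.mem_filter, Finset.mem_univ, true_and]
      constructor
      · rintro ⟨h1, h2⟩ p
        rcases hσ : σ p with _ | _ | _
        · exact sign_eq_zero_iff.2 (h2 _ ⟨p, hσ, rfl⟩)
        · have := h1 _ (Or.inr ⟨p, hσ, rfl⟩)
          rw [map_neg, neg_pos] at this
          exact sign_eq_neg_one_iff.2 this
        · exact sign_eq_one_iff.2 (h1 _ (Or.inl ⟨p, hσ, rfl⟩))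
      · refine fun h => ⟨?_, ?_⟩
        · rintro f (⟨p, hp, rfl⟩ | ⟨p, hp, rfl⟩)
          · rw [← sign_eq_one_iff, h, hp]
          · rw [map_neg, neg_pos, ← sign_eq_neg_one_iff, h, hp]
        · rintro f ⟨p, hp, rfl⟩
          rw [← sign_eq_zero_iff, h, hp]
    ext x
    simp only [Set.mem_iUnion, Set.mem_ofPred_eq, key]
    constructor
    · intro hx
      refine ⟨e ⟨fun p => SignType.sign (MvPolynomial.eval x p.1), x, hx, fun _ => rfl⟩, ?_⟩
      simp
    · rintro ⟨i, hi⟩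
      obtain ⟨y, hy, hyσ⟩ := (e.symm i).2
      exact hF y x (fun p hp => by rw [hyσ ⟨p, hp⟩, hi ⟨p, hp⟩]) hy

end SemialgebraicPredicates

/-! ### Polynomial growth of semi-algebraic functions of one variable -/

section PolynomialGrowth

open Polynomial in
lemma Polynomial.exists_abs_eval_le (p : ℝ[X]) :
    ∃ C : ℝ, 0 ≤ C ∧ ∀ r : ℝ, 1 ≤ r → |p.eval r| ≤ C * r ^ p.natDegree := by
  refine ⟨∑ i ∈ Finset.range (p.natDegree + 1), |p.coeff i|,
    Finset.sum_nonneg fun _ _ => abs_nonneg _, fun r hr => ?_⟩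
  rw [Polynomial.eval_eq_sum_range, Finset.sum_mul]
  refine (Finset.abs_sum_le_sum_abs _ _).trans (Finset.sum_le_sum fun i hi => ?_)
  rw [abs_mul, abs_pow, abs_of_nonneg (zero_le_one.trans hr)]
  exact mul_le_mul_of_nonneg_left
    (pow_le_pow_right₀ hr (Nat.lt_succ_iff.1 (Finset.mem_range.1 hi))) (abs_nonneg _)

open Polynomial in
lemma Polynomial.exists_pos_eventually_le_abs_eval {p : ℝ[X]} (hp : p ≠ 0) :
    ∃ c : ℝ, 0 < c ∧ ∀ᶠ r in atTop, c ≤ |p.eval r| := by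
  by_cases hd : 0 < p.degree
  · exact ⟨1, one_pos, (p.abs_tendsto_atTop hd).eventually_ge_atTop 1⟩
  · have h := Polynomial.eq_C_of_degree_le_zero (not_lt.1 hd)
    have h0 : p.coeff 0 ≠ 0 := fun h0 => hp (by rw [h, h0, C_0])
    refine ⟨|p.coeff 0|, abs_pos.2 h0, Eventually.of_forall fun r => ?_⟩
    rw [h]; simp

/-- The real roots of a one-parameter family of polynomials grow at most polynomially in the
parameter. -/
lemma Polynomial.exists_abs_root_le {q : Polynomial (Polynomial ℝ)} (hq : q ≠ 0) :
    ∃ (C : ℝ) (N : ℕ), 0 ≤ C ∧ ∀ᶠ r in atTop, ∀ s : ℝ,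
      (q.map (Polynomial.evalRingHom r)).eval s = 0 → |s| ≤ C * r ^ N := by
  obtain ⟨c, hc, hev⟩ := Polynomial.exists_pos_eventually_le_abs_eval
    (Polynomial.leadingCoeff_ne_zero.2 hq)
  choose C hC0 hC using fun i => Polynomial.exists_abs_eval_le (q.coeff i)
  set N := ∑ i ∈ Finset.range q.natDegree, (q.coeff i).natDegree with hN
  set S := ∑ i ∈ Finset.range q.natDegree, C i with hS
  have hS0 : 0 ≤ S := Finset.sum_nonneg fun i _ => hC0 i
  refine ⟨S / c + 1, N, by positivity, ?_⟩
  filter_upwards [hev, eventually_ge_atTop 1] with r hr hr1 s hs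
  have hr0 : 0 ≤ r := zero_le_one.trans hr1
  -- For large `r` the degree does not drop, and the Cauchy bound applies with a leading coefficient
  -- bounded away from zero.
  have hlc : Polynomial.evalRingHom r q.leadingCoeff ≠ 0 := by
    rw [Polynomial.coe_evalRingHom]
    exact fun h0 => by rw [h0, abs_zero] at hr; linarith
  have hdeg := Polynomial.natDegree_map_of_leadingCoeff_ne_zero _ hlc
  have hne : q.map (Polynomial.evalRingHom r) ≠ 0 := fun h0 => by
    have := congrArg (fun p => Polynomial.coeff p q.natDegree) h0
    rw [Polynomial.coeff_map, Polynomial.coeff_zero] at this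
    exact hlc this
  have hb := (Polynomial.IsRoot.norm_lt_cauchyBound hne (a := s) hs).le
  rw [Polynomial.cauchyBound, hdeg, Polynomial.leadingCoeff, hdeg, Polynomial.coeff_map] at hb
  have hb' : |s| ≤ (((Finset.range q.natDegree).sup fun x =>
      ‖(q.map (Polynomial.evalRingHom r)).coeff x‖₊ : NNReal) : ℝ) /
        |q.leadingCoeff.eval r| + 1 := by
    exact_mod_cast hb
  have hsup : (((Finset.range q.natDegree).sup fun x =>
      ‖(q.map (Polynomial.evalRingHom r)).coeff x‖₊ : NNReal) : ℝ) ≤ S * r ^ N := by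
    have hnn : (0 : ℝ) ≤ S * r ^ N := by positivity
    have : ((Finset.range q.natDegree).sup fun x =>
      ‖(q.map (Polynomial.evalRingHom r)).coeff x‖₊) ≤ (⟨S * r ^ N, hnn⟩ : NNReal) := by
      refine Finset.sup_le fun i hi => ?_
      change ‖(q.map (Polynomial.evalRingHom r)).coeff i‖ ≤ S * r ^ N
      rw [Polynomial.coeff_map, Polynomial.coe_evalRingHom, Real.norm_eq_abs]
      refine (hC i r hr1).trans (mul_le_mul ?_ ?_ (by positivity) hS0)
      · exact Finset.single_le_sum (f := C) (fun i _ => hC0 i) hi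
      · exact pow_le_pow_right₀ hr1
          (Finset.single_le_sum (f := fun i => (q.coeff i).natDegree) (fun _ _ => Nat.zero_le _) hi)
    exact_mod_cast this
  have h1 : (1 : ℝ) ≤ r ^ N := one_le_pow₀ hr1
  calc |s| ≤ S * r ^ N / c + 1 := by
        refine hb'.trans (add_le_add_left ?_ _)
        exact div_le_div₀ (by positivity) hsup hc hr
    _ = S / c * r ^ N + 1 := by ring
    _ ≤ (S / c + 1) * r ^ N := by linarith

/-- A semi-algebraic relation in the plane that is the graph of a partial function is contained in
an algebraic curve. -/
lemma SemialgPred.exists_annihilator {ι : Type} {P : (Option ι → ℝ) → Prop} (hP : SemialgPred P)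
    (hfun : ∀ z w : Option ι → ℝ, P z → P w → (∀ i, z (some i) = w (some i)) →
      z none = w none) :
    ∃ q : MvPolynomial (Option ι) ℝ, q ≠ 0 ∧ ∀ z, P z → MvPolynomial.eval z q = 0 := by
  classical
  obtain ⟨F, hF⟩ := hP
  -- If no nonzero polynomial of `F` vanished at `z`, a small change of the last coordinate would
  -- preserve all the signs, and hence `P`; the relation would not be single-valued.
  refine ⟨∏ p ∈ F.filter (· ≠ 0), p, Finset.prod_ne_zero_iff.2 fun p hp =>
    (Finset.mem_filter.1 hp).2, fun z hz => ?_⟩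
  rw [map_prod, Finset.prod_eq_zero_iff]
  by_contra! hne
  let γ : ℝ → Option ι → ℝ := fun t => Function.update z none t
  have hγ : Continuous γ := continuous_const.update none continuous_id
  have hγz : γ (z none) = z := Function.update_eq_self none z
  have hev : ∀ᶠ t in 𝓝 (z none), ∀ p ∈ F, SignType.sign (MvPolynomial.eval z p) =
      SignType.sign (MvPolynomial.eval (γ t) p) := by
    rw [Filter.eventually_all_finset]
    intro p hp
    by_cases hp0 : p = 0
    · simp [hp0]
    have h0 : MvPolynomial.eval (γ (z none)) p ≠ 0 := by
      rw [hγz]; exact hne p (Finset.mem_filter.2 ⟨hp, hp0⟩)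
    have hc : ContinuousAt (fun t => SignType.sign (MvPolynomial.eval (γ t) p)) (z none) :=
      ContinuousAt.comp (f := fun t => MvPolynomial.eval (γ t) p) (continuousAt_sign_of_ne_zero h0)
        ((MvPolynomial.continuous_eval p).comp hγ).continuousAt
    filter_upwards [hc.eventually (eventually_nhds_iff.2 ⟨{SignType.sign
      (MvPolynomial.eval (γ (z none)) p)}, fun _ h => h, isOpen_discrete _, rfl⟩)] with t ht
    rw [← hγz]
    exact (Set.mem_singleton_iff.1 ht).symm ▸ by rw [hγz]
  obtain ⟨t, ht, htne⟩ : ∃ t, (∀ p ∈ F, SignType.sign (MvPolynomial.eval z p) =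
      SignType.sign (MvPolynomial.eval (γ t) p)) ∧ t ≠ z none :=
    ((hev.filter_mono nhdsWithin_le_nhds).and self_mem_nhdsWithin).exists (f := 𝓝[≠] (z none))
  have := hfun z (γ t) hz (hF z _ ht hz) fun i => by simp [γ]
  exact htne (by simpa [γ] using this.symm)

/-- A semi-algebraic partial function of one real variable grows at most polynomially. -/
lemma SemialgPred.exists_abs_le {P : (Option Unit → ℝ) → Prop} (hP : SemialgPred P)
    (hfun : ∀ z w : Option Unit → ℝ, P z → P w → (∀ i, z (some i) = w (some i)) →
      z none = w none) :
    ∃ (C : ℝ) (N : ℕ), 0 ≤ C ∧ ∀ᶠ r in atTop, ∀ s : ℝ,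
      P (fun o => o.elim s fun _ => r) → |s| ≤ C * r ^ N := by
  obtain ⟨q, hq0, hq⟩ := hP.exists_annihilator hfun
  let e := MvPolynomial.uniqueAlgEquiv ℝ Unit
  let Q := (MvPolynomial.optionEquivLeft ℝ Unit q).map (e : MvPolynomial Unit ℝ →+* Polynomial ℝ)
  have hQ : Q ≠ 0 := by
    rw [Ne, Polynomial.map_eq_zero_iff e.injective]
    simpa using hq0
  obtain ⟨C, N, hC, h⟩ := Polynomial.exists_abs_root_le hQ
  refine ⟨C, N, hC, ?_⟩
  filter_upwards [h] with r hr s hs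
  refine hr s ?_
  have h0 := hq _ hs
  rw [MvPolynomial.optionEquivLeft_elim_eval] at h0
  rw [Polynomial.map_map]
  convert! h0 using 3
  refine RingHom.ext fun b => ?_
  exact MvPolynomial.eval₂_const_uniqueAlgEquiv (R := ℝ) (f := b) (φ := RingHom.id ℝ) (a := r)

end PolynomialGrowth

/-! ### Polynomial growth of Nash functions -/

section SemialgebraicFunctions

variable {n : ℕ} {M : Set (EuclideanSpace ℝ (Fin n))}

/-- The graph of `f : M → ℝ` as a relation between coordinate vectors and reals. -/
def GraphRel (f : M → ℝ) (y : Fin n → ℝ) (u : ℝ) : Prop :=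
  ∃ h : WithLp.toLp 2 y ∈ M, f ⟨_, h⟩ = u

lemma graphRel_coe (f : M → ℝ) (x : M) : GraphRel f x.1.ofLp (f x) := ⟨x.2, rfl⟩

lemma isSemialgebraicFun_iff {f : M → ℝ} :
    IsSemialgebraicFun f ↔
      SemialgPred fun z : Fin (n + 1) → ℝ => GraphRel f (fun i => z i.castSucc) (z (Fin.last n)) := by
  rw [IsSemialgebraicFun, isSemialgebraic_iff]
  have : ∀ z : Fin (n + 1) → ℝ, (z ∈ {z : Fin (n + 1) → ℝ |
      ∃ x : M, z = Fin.snoc (α := fun _ => ℝ) (fun i => x.1 i) (f x)}) ↔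
        GraphRel f (fun i => z i.castSucc) (z (Fin.last n)) := by
    intro z
    constructor
    · rintro ⟨x, rfl⟩
      simp only [Fin.snoc_castSucc, Fin.snoc_last]
      exact graphRel_coe f x
    · rintro ⟨h, hf⟩
      refine ⟨⟨_, h⟩, ?_⟩
      rw [hf]
      exact (Fin.snoc_init_self z).symm
  exact ⟨fun h => h.congr fun z => (this z).symm, fun h => h.congr this⟩

lemma IsSemialgebraicFun.comp {f : M → ℝ} (hf : IsSemialgebraicFun f) {κ : Type}
    {g : (κ → ℝ) → Fin n → ℝ} {u : (κ → ℝ) → ℝ} (hg : ∀ i, IsPolyMap fun x => g x i)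
    (hu : IsPolyMap u) : SemialgPred fun x => GraphRel f (g x) (u x) := by
  have h := (isSemialgebraicFun_iff.1 hf).comp
    (g := fun x => Fin.snoc (α := fun _ => ℝ) (g x) (u x)) (by
      intro i
      refine Fin.lastCases ?_ (fun j => ?_) i
      · simpa using hu
      · simpa using hg j)
  simpa using h

lemma SmoothFun.continuous {f : M → ℝ} (hf : f ∈ SmoothFun M) : Continuous f := by
  rw [continuous_iff_continuousAt]
  intro x
  obtain ⟨g, hg, he⟩ := hf x
  exact ((hg.continuous.comp continuous_subtype_val).continuousAt (x := x)).congr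
    (he.mono fun y hy => hy.symm)

/-- A Nash function on a closed subset of `ℝⁿ` grows at most polynomially. -/
theorem IsNashFun.exists_abs_le {f : M → ℝ} (hf : IsNashFun f) (hM : IsClosed M) :
    ∃ (C : ℝ) (N : ℕ), ∀ x : M, |f x| ≤ C * (1 + ‖x.1‖ ^ 2) ^ N := by
  have hbdd : ∀ r : ℝ, ∃ B, 0 ≤ B ∧ ∀ x : M, ‖x.1‖ ^ 2 ≤ r → |f x| ≤ B := by
    intro r
    have hK : IsCompact {x : M | ‖x.1‖ ^ 2 ≤ r} := by
      rw [Topology.IsEmbedding.subtypeVal.isCompact_iff]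
      refine ((isCompact_closedBall (0 : EuclideanSpace ℝ (Fin n)) (1 + |r|)).inter_right
        hM).of_isClosed_subset ?_ ?_
      · refine hM.isClosedEmbedding_subtypeVal.isClosedMap _ ?_
        exact isClosed_le (by fun_prop) continuous_const
      · rintro _ ⟨x, hx, rfl⟩
        refine ⟨mem_closedBall_zero_iff.2 ?_, x.2⟩
        have h1 : ‖x.1‖ ^ 2 ≤ r := hx
        nlinarith [le_abs_self r, abs_nonneg r, norm_nonneg x.1, sq_nonneg (‖x.1‖ - 1)]
    obtain ⟨B, hB⟩ := hK.exists_bound_of_continuousOn (SmoothFun.continuous hf.1).continuousOn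
    exact ⟨|B|, abs_nonneg _, fun x hx => (hB x hx).trans (le_abs_self B)⟩
  -- `z none` is the least upper bound of the squares of the values of `f` at the points of squared
  -- norm `z (some ())`. Stating the least upper bound by quantifiers makes the relation
  -- semi-algebraic, and uniqueness makes it a partial function of one variable.
  let P : (Option Unit → ℝ) → Prop := fun z =>
    (∀ y : Fin n → ℝ, ∀ u : ℝ, GraphRel f y u → ∑ i, y i ^ 2 = z (some ()) → u ^ 2 ≤ z none) ∧
    ∀ s : ℝ, (∀ y : Fin n → ℝ, ∀ u : ℝ, GraphRel f y u → ∑ i, y i ^ 2 = z (some ()) → u ^ 2 ≤ s) →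
      z none ≤ s
  have hP : SemialgPred P := by
    refine .and (.forall_vec (.forall_real (.imp (hf.2.comp (fun i => .coord _) (.coord _))
      (.imp (.eq (.sum fun i => .pow (.coord _) 2) (.coord _))
        (.le (.pow (.coord _) 2) (.coord _)))))) ?_
    exact .forall_real (.imp (.forall_vec (.forall_real (.imp
      (hf.2.comp (fun i => .coord _) (.coord _))
      (.imp (.eq (.sum fun i => .pow (.coord _) 2) (.coord _))
        (.le (.pow (.coord _) 2) (.coord _)))))) (.le (.coord _) (.coord _)))
  obtain ⟨C, N, hC, hev⟩ := hP.exists_abs_le (by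
    intro z w hz hw h
    have h' := h ()
    refine le_antisymm (hz.2 _ ?_) (hw.2 _ ?_)
    · rw [h']; exact hw.1
    · rw [← h']; exact hz.1)
  obtain ⟨r₀, hr₀⟩ := eventually_atTop.1 hev
  obtain ⟨B, hB0, hB⟩ := hbdd r₀
  -- `B` serves the compact part `‖x‖ ^ 2 ≤ r₀`; outside it, `1 + C` comes from `|f x| ≤ 1 + f x ^
  -- 2`.
  refine ⟨B + 1 + C, N, fun x => ?_⟩
  have h1 : 1 ≤ (1 + ‖x.1‖ ^ 2) ^ N := one_le_pow₀ (by nlinarith [sq_nonneg ‖x.1‖])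
  rcases le_total (‖x.1‖ ^ 2) r₀ with hx | hx
  · have := hB x hx
    nlinarith
  set S : Set ℝ := {v | ∃ y : M, ‖y.1‖ ^ 2 = ‖x.1‖ ^ 2 ∧ v = f y ^ 2} with hS
  have hSne : S.Nonempty := ⟨_, x, rfl, rfl⟩
  have hSbdd : BddAbove S := by
    obtain ⟨B', hB'0, hB'⟩ := hbdd (‖x.1‖ ^ 2)
    refine ⟨B' ^ 2, ?_⟩
    rintro _ ⟨y, hy, rfl⟩
    exact sq_le_sq' (abs_le.1 (hB' y hy.le)).1 (abs_le.1 (hB' y hy.le)).2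
  have hlub := isLUB_csSup hSne hSbdd
  have hPs : P (fun o => o.elim (sSup S) fun _ => ‖x.1‖ ^ 2) := by
    constructor
    · rintro y u ⟨hy, rfl⟩ hyr
      refine hlub.1 ⟨⟨_, hy⟩, ?_, rfl⟩
      rw [EuclideanSpace.real_norm_sq_eq]
      exact hyr
    · intro s hs
      refine hlub.2 ?_
      rintro _ ⟨y, hy, rfl⟩
      refine hs _ _ (graphRel_coe f y) ?_
      rw [EuclideanSpace.real_norm_sq_eq] at hy
      exact hy
  have h2 := (le_abs_self _).trans (hr₀ _ hx _ hPs)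
  have h3 : f x ^ 2 ≤ sSup S := hlub.1 ⟨x, rfl, rfl⟩
  have h4 : |f x| ≤ 1 + f x ^ 2 := by nlinarith [sq_abs (f x), sq_nonneg (|f x| - 1)]
  have h5 : (‖x.1‖ ^ 2) ^ N ≤ (1 + ‖x.1‖ ^ 2) ^ N :=
    pow_le_pow_left₀ (by positivity) (by linarith) N
  have h6 := mul_le_mul_of_nonneg_left h5 hC
  nlinarith

end SemialgebraicFunctions

/-! ### Polynomial functions and their differentials -/

section PolyEval

variable {n : ℕ}

lemma polyEval_add (p q : MvPolynomial (Fin n) ℝ) (x : EuclideanSpace ℝ (Fin n)) :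
    polyEval (p + q) x = polyEval p x + polyEval q x := map_add _ _ _

lemma polyEval_mul (p q : MvPolynomial (Fin n) ℝ) (x : EuclideanSpace ℝ (Fin n)) :
    polyEval (p * q) x = polyEval p x * polyEval q x := map_mul _ _ _

lemma polyEval_pow (p : MvPolynomial (Fin n) ℝ) (k : ℕ) (x : EuclideanSpace ℝ (Fin n)) :
    polyEval (p ^ k) x = polyEval p x ^ k := map_pow _ _ _

lemma polyEval_sum {α : Type*} (s : Finset α) (p : α → MvPolynomial (Fin n) ℝ)
    (x : EuclideanSpace ℝ (Fin n)) : polyEval (∑ i ∈ s, p i) x = ∑ i ∈ s, polyEval (p i) x :=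
  map_sum _ _ _

@[simp] lemma polyEval_C (c : ℝ) (x : EuclideanSpace ℝ (Fin n)) :
    polyEval (MvPolynomial.C c) x = c := MvPolynomial.eval_C _

@[simp] lemma polyEval_X (i : Fin n) (x : EuclideanSpace ℝ (Fin n)) :
    polyEval (MvPolynomial.X i) x = x i := MvPolynomial.eval_X _

@[simp] lemma polyEval_one (x : EuclideanSpace ℝ (Fin n)) :
    polyEval (1 : MvPolynomial (Fin n) ℝ) x = 1 := map_one _

@[simp] lemma polyEval_zero (x : EuclideanSpace ℝ (Fin n)) :
    polyEval (0 : MvPolynomial (Fin n) ℝ) x = 0 := map_zero _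

/-- A property of functions that holds for constants and coordinates and is closed under sums and
products holds for polynomial functions. -/
lemma polyEval_induction {T : (EuclideanSpace ℝ (Fin n) → ℝ) → Prop} (hc : ∀ c, T fun _ => c)
    (hX : ∀ i, T fun x => x i) (hadd : ∀ f g, T f → T g → T fun x => f x + g x)
    (hmul : ∀ f g, T f → T g → T fun x => f x * g x) (p : MvPolynomial (Fin n) ℝ) :
    T (polyEval p) := by
  induction p using MvPolynomial.induction_on with
  | C a => simpa [funext fun x => polyEval_C (n := n) a x] using hc a
  | add p q hp hq =>
    rw [show polyEval (p + q) = fun x => polyEval p x + polyEval q x from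
      funext (polyEval_add p q)]
    exact hadd _ _ hp hq
  | mul_X p i hp =>
    rw [show polyEval (p * MvPolynomial.X i) = fun x => polyEval p x * x i from
      funext fun x => by rw [polyEval_mul, polyEval_X]]
    exact hmul _ _ hp (hX i)

lemma contDiff_polyEval {k : WithTop ℕ∞} (p : MvPolynomial (Fin n) ℝ) :
    ContDiff ℝ k (polyEval p) :=
  polyEval_induction (T := fun f => ContDiff ℝ k f) (fun _ => contDiff_const)
    (fun i => (EuclideanSpace.proj (𝕜 := ℝ) i).contDiff) (fun _ _ hf hg => hf.add hg)
    (fun _ _ hf hg => hf.mul hg) p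

lemma continuous_polyEval (p : MvPolynomial (Fin n) ℝ) : Continuous (polyEval p) :=
  (contDiff_polyEval (k := 0) p).continuous

/-- The differential of a polynomial function. -/
noncomputable def polyDifferential (p : MvPolynomial (Fin n) ℝ) (x : EuclideanSpace ℝ (Fin n)) :
    EuclideanSpace ℝ (Fin n) →L[ℝ] ℝ :=
  ∑ j, polyEval (MvPolynomial.pderiv j p) x • EuclideanSpace.proj j

lemma polyDifferential_apply (p : MvPolynomial (Fin n) ℝ) (x v : EuclideanSpace ℝ (Fin n)) :
    polyDifferential p x v = ∑ j, polyEval (MvPolynomial.pderiv j p) x * v j := by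
  simp [polyDifferential]

lemma hasStrictFDerivAt_polyEval (p : MvPolynomial (Fin n) ℝ) (x : EuclideanSpace ℝ (Fin n)) :
    HasStrictFDerivAt (polyEval p) (polyDifferential p x) x := by
  induction p using MvPolynomial.induction_on with
  | C a =>
    have h0 : polyDifferential (MvPolynomial.C a) x = 0 := by
      ext v; simp [polyDifferential_apply]
    rw [h0, show polyEval (n := n) (MvPolynomial.C a) = fun _ => a from funext (polyEval_C a)]
    exact hasStrictFDerivAt_const a x
  | add p q hp hq =>
    have h0 : polyDifferential (p + q) x = polyDifferential p x + polyDifferential q x := by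
      ext v; simp [polyDifferential_apply, polyEval_add, add_mul, Finset.sum_add_distrib]
    rw [h0, show polyEval (p + q) = fun x => polyEval p x + polyEval q x from
      funext (polyEval_add p q)]
    exact hp.add hq
  | mul_X p i hp =>
    have hX : HasStrictFDerivAt (fun x : EuclideanSpace ℝ (Fin n) => x i)
        (EuclideanSpace.proj (𝕜 := ℝ) i) x := (EuclideanSpace.proj (𝕜 := ℝ) i).hasStrictFDerivAt
    rw [show polyEval (p * MvPolynomial.X i) = fun x => polyEval p x * x i from
      funext fun x => by rw [polyEval_mul, polyEval_X]]
    convert! hp.mul hX using 1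
    ext v
    simp only [polyDifferential_apply, MvPolynomial.pderiv_mul, polyEval_add, polyEval_mul,
      polyEval_X, add_mul, Finset.sum_add_distrib]
    simp only [add_apply, smul_apply, polyDifferential_apply, smul_eq_mul, Finset.mul_sum,
      PiLp.proj_apply]
    rw [add_comm]
    congr 1
    · rw [Finset.sum_eq_single i]
      · simp
      · intro j _ hj
        rw [MvPolynomial.pderiv_X_of_ne (Ne.symm hj)]
        simp
      · simp
    · exact Finset.sum_congr rfl fun j _ => by ring

end PolyEval

/-! ### Closure properties of Nash functions -/

section NashFunctions

variable {n : ℕ} {M : Set (EuclideanSpace ℝ (Fin n))}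

lemma IsSmoothRealAffineVariety.isClosed (hM : IsSmoothRealAffineVariety M) : IsClosed M := by
  obtain ⟨S, rfl⟩ := hM.algebraic
  have : {x | ∀ p ∈ S, polyEval p x = 0} = ⋂ p ∈ S, {x | polyEval p x = 0} := by ext; simp
  rw [this]
  exact isClosed_biInter fun p _ => isClosed_eq (continuous_polyEval p) continuous_const

lemma IsPolyMap.polyEval_comp {ι : Type} {g : (ι → ℝ) → Fin n → ℝ}
    (hg : ∀ i, IsPolyMap fun x => g x i) (p : MvPolynomial (Fin n) ℝ) :
    IsPolyMap fun x => polyEval p (WithLp.toLp 2 (g x)) :=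
  IsPolyMap.eval_comp hg p

lemma SemialgPred.forall_finset {ι α : Type} (s : Finset α) {P : α → (ι → ℝ) → Prop}
    (h : ∀ a, SemialgPred (P a)) : SemialgPred fun x => ∀ a ∈ s, P a x := by
  classical
  induction s using Finset.induction_on with
  | empty => exact ⟨∅, by simp⟩
  | insert a s _ ih => exact ((h a).and ih).congr fun x => by simp

/-- An algebraic subset of `ℝⁿ` is semi-algebraic, by Hilbert's basis theorem. -/
lemma IsSmoothRealAffineVariety.semialgPred (hM : IsSmoothRealAffineVariety M) :
    SemialgPred fun y : Fin n → ℝ => WithLp.toLp 2 y ∈ M := by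
  obtain ⟨S, rfl⟩ := hM.algebraic
  obtain ⟨T, hTS, hT⟩ := (Submodule.fg_span_iff_fg_span_finset_subset S).1
    (IsNoetherian.noetherian (Ideal.span S))
  refine (SemialgPred.forall_finset T (P := fun p y => polyEval p (WithLp.toLp 2 y) = 0)
    fun p => .eq (.polyEval_comp (fun i => .coord i) p) (.const 0)).congr fun y => ?_
  refine ⟨fun h p hp => h p (hTS hp), fun h p hp => ?_⟩
  have hle : Ideal.span (T : Set (MvPolynomial (Fin n) ℝ)) ≤
      RingHom.ker (MvPolynomial.eval y) := Ideal.span_le.2 fun p hp => h p hp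
  have hp' : p ∈ Ideal.span (T : Set (MvPolynomial (Fin n) ℝ)) := by
    have := Ideal.subset_span hp
    rwa [Ideal.span, hT] at this
  exact hle hp'

lemma IsPolynomialFun.mem_smoothFun {f : M → ℝ} (hf : IsPolynomialFun f) : f ∈ SmoothFun M := by
  obtain ⟨p, hp⟩ := hf
  exact fun x => ⟨polyEval p, contDiff_polyEval p, Eventually.of_forall hp⟩

lemma IsPolynomialFun.isNashFun (hM : IsSmoothRealAffineVariety M) {f : M → ℝ}
    (hf : IsPolynomialFun f) : IsNashFun f := by
  refine ⟨hf.mem_smoothFun, isSemialgebraicFun_iff.2 ?_⟩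
  obtain ⟨p, hp⟩ := hf
  refine ((hM.semialgPred.comp (g := fun z : Fin (n + 1) → ℝ => fun i => z i.castSucc)
    fun i => .coord _).and (.eq (.polyEval_comp (fun i => .coord (Fin.castSucc i)) p)
      (.coord (Fin.last n)))).congr fun z => ?_
  constructor
  · rintro ⟨h, h'⟩
    exact ⟨h, by rw [← h', hp]⟩
  · rintro ⟨h, h'⟩
    exact ⟨h, by rw [hp, ← h']⟩

/-- The graph of the product is described with the values of the two factors existentially
quantified, so Tarski–Seidenberg applies. -/
lemma IsNashFun.mul {f g : M → ℝ} (hf : IsNashFun f) (hg : IsNashFun g) : IsNashFun (f * g) := by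
  refine ⟨(SmoothFun M).mul_mem hf.1 hg.1, isSemialgebraicFun_iff.2 ?_⟩
  refine (SemialgPred.exists_real (.exists_real (.and (hf.2.comp (fun i => .coord _) (.coord _))
    (.and (hg.2.comp (fun i => .coord _) (.coord _)) (.eq (.coord _)
      (.mul (.coord _) (.coord _))))))).congr (ι := Fin (n + 1))
    (P := fun z => ∃ a b, GraphRel f (fun i => z i.castSucc) a ∧
      GraphRel g (fun i => z i.castSucc) b ∧ z (Fin.last n) = a * b) fun z => ?_
  constructor
  · rintro ⟨h, h'⟩
    exact ⟨_, _, ⟨h, rfl⟩, ⟨h, rfl⟩, h'.symm⟩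
  · rintro ⟨a, b, ⟨h, rfl⟩, ⟨_, rfl⟩, h'⟩
    exact ⟨h, h'.symm⟩

/-- The reciprocal of a polynomial without zeros on `M` is smooth on `M`. -/
lemma inv_polyEval_mem_smoothFun {w : MvPolynomial (Fin n) ℝ} (hw : ∀ x ∈ M, polyEval w x ≠ 0) :
    (fun x : M => (polyEval w x)⁻¹) ∈ SmoothFun M := by
  intro x
  set c := polyEval w x ^ 2 with hc
  have hc0 : 0 < c := by have := hw x x.2; positivity
  -- `v` is positive everywhere and equals `polyEval w y ^ 2` wherever that is at least `c / 2`.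
  -- Hence `polyEval w y / v y` is smooth on all of `ℝⁿ` and agrees with the reciprocal near `x`.
  let v : EuclideanSpace ℝ (Fin n) → ℝ := fun y =>
    polyEval w y ^ 2 + (1 - Real.smoothTransition (2 * polyEval w y ^ 2 / c))
  have hv : ∀ y, v y ≠ 0 := by
    intro y
    by_cases h0 : polyEval w y = 0
    · simp [v, h0, Real.smoothTransition.zero_of_nonpos]
    · have := Real.smoothTransition.le_one (2 * polyEval w y ^ 2 / c)
      have h1 : 0 < polyEval w y ^ 2 := by positivity
      exact ne_of_gt (by dsimp only [v]; linarith)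
  have hvs : ContDiff ℝ ∞ v :=
    ((contDiff_polyEval w).pow 2).add (contDiff_const.sub (Real.smoothTransition.contDiff.comp
      ((contDiff_const.mul ((contDiff_polyEval w).pow 2)).div_const c)))
  refine ⟨fun y => polyEval w y / v y, (contDiff_polyEval w).div hvs hv, ?_⟩
  have hcont : Continuous fun y : M => 2 * polyEval w y ^ 2 :=
    continuous_const.mul (((continuous_polyEval w).comp continuous_subtype_val).pow 2)
  filter_upwards [hcont.continuousAt.eventually_const_lt (u := c) (by linarith : c < 2 * c)]
    with y hy
  have h1 : v y = polyEval w y ^ 2 := by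
    dsimp only [v]
    rw [Real.smoothTransition.one_of_one_le ((one_le_div hc0).2 hy.le)]
    ring
  have h2 := hw y y.2
  rw [h1]
  field_simp

lemma IsNashFun.inv_polyEval (hM : IsSmoothRealAffineVariety M) {w : MvPolynomial (Fin n) ℝ}
    (hw : ∀ x ∈ M, polyEval w x ≠ 0) : IsNashFun fun x : M => (polyEval w x)⁻¹ := by
  refine ⟨inv_polyEval_mem_smoothFun hw, isSemialgebraicFun_iff.2 ?_⟩
  refine ((hM.semialgPred.comp (g := fun z : Fin (n + 1) → ℝ => fun i => z i.castSucc)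
    fun i => .coord _).and (.eq (.mul (.polyEval_comp (fun i => .coord (Fin.castSucc i)) w)
      (.coord (Fin.last n))) (.const 1))).congr fun z => ?_
  constructor
  · rintro ⟨h, h'⟩
    exact ⟨h, by rw [← h', mul_inv_cancel₀ (hw _ h)]⟩
  · rintro ⟨h, h'⟩
    exact ⟨h, (eq_inv_of_mul_eq_one_right h').symm⟩

/-- The derivative of `φ` along `X` may be computed with any differential of `φ` along `M`. -/
lemma SmoothVectorField.derivFun_eq_of_hasFDerivWithinAt (X : SmoothVectorField M) (φ : SmoothFun M)
    (x : M) {F : EuclideanSpace ℝ (Fin n) → ℝ} (hF : ∀ y : M, F y = φ.1 y)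
    {L : EuclideanSpace ℝ (Fin n) →L[ℝ] ℝ} (hL : HasFDerivWithinAt F L M x) :
    X.derivFun φ x = L (X.toFun x) := by
  obtain ⟨g, hg⟩ := φ.2 x
  rw [X.derivFun_eq φ x hg]
  have h1 : HasFDerivWithinAt g (fderiv ℝ g x) M x :=
    ((hg.1.differentiable (by simp)) _).hasFDerivAt.hasFDerivWithinAt
  have hev : F =ᶠ[𝓝[M] (x : EuclideanSpace ℝ (Fin n))] g := by
    rw [← map_nhds_subtype_val]
    exact Filter.eventually_map.2 (hg.2.mono fun y h => (hF y).trans h)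
  exact (h1.congr_of_eventuallyEq hev (hev.self_of_nhdsWithin x.2)).unique_on hL (X.tangent x)

/-- The linear form with coefficients `ℓ`. -/
noncomputable def linearForm (ℓ : Fin n → ℝ) : EuclideanSpace ℝ (Fin n) →L[ℝ] ℝ :=
  ∑ j, ℓ j • EuclideanSpace.proj j

lemma linearForm_apply (ℓ : Fin n → ℝ) (v : EuclideanSpace ℝ (Fin n)) :
    linearForm ℓ v = ∑ j, ℓ j * v j := by
  simp [linearForm]

lemma exists_linearForm_eq (L : EuclideanSpace ℝ (Fin n) →L[ℝ] ℝ) : ∃ ℓ, L = linearForm ℓ := by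
  refine ⟨fun i => L (EuclideanSpace.single i 1), ?_⟩
  ext v
  have hdec : v = ∑ i, v i • EuclideanSpace.single i (1 : ℝ) := by
    ext j
    simp [Finset.sum_apply, Pi.single_apply]
  conv_lhs => rw [hdec]
  rw [linearForm_apply, map_sum]
  exact Finset.sum_congr rfl fun i _ => by rw [map_smul, smul_eq_mul, mul_comm]

/-- Differentiability along `M`, expressed by inequalities between squares. -/
lemma hasFDerivWithinAt_linearForm_iff {f : M → ℝ} {F : EuclideanSpace ℝ (Fin n) → ℝ}
    (hF : ∀ y : M, F y = f y) (x : M) (ℓ : Fin n → ℝ) :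
    HasFDerivWithinAt F (linearForm ℓ) M x ↔
      ∀ ε : ℝ, 0 < ε → ∃ δ : ℝ, 0 < δ ∧ ∀ (y : Fin n → ℝ) (u : ℝ), GraphRel f y u →
        ∑ i, (y i - x.1 i) ^ 2 < δ ^ 2 →
          (u - f x - ∑ i, ℓ i * (y i - x.1 i)) ^ 2 ≤ ε ^ 2 * ∑ i, (y i - x.1 i) ^ 2 := by
  rw [hasFDerivWithinAt_iff_isLittleO, Asymptotics.isLittleO_iff]
  refine forall_congr' fun ε => imp_congr_right fun hε => ?_
  rw [Metric.nhdsWithin_basis_ball.eventually_iff]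
  refine exists_congr fun δ => and_congr_right fun hδ => ?_
  have key : ∀ (y : Fin n → ℝ) (hy : WithLp.toLp 2 y ∈ M),
      ((WithLp.toLp 2 y ∈ Metric.ball x.1 δ ∩ M ↔ ∑ i, (y i - x.1 i) ^ 2 < δ ^ 2) ∧
        (‖F (WithLp.toLp 2 y) - F x - linearForm ℓ (WithLp.toLp 2 y - x.1)‖ ≤
            ε * ‖WithLp.toLp 2 y - x.1‖ ↔
          (f ⟨_, hy⟩ - f x - ∑ i, ℓ i * (y i - x.1 i)) ^ 2 ≤
            ε ^ 2 * ∑ i, (y i - x.1 i) ^ 2)) := by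
    intro y hy
    have hn : ‖WithLp.toLp 2 y - x.1‖ ^ 2 = ∑ i, (y i - x.1 i) ^ 2 := by
      rw [EuclideanSpace.real_norm_sq_eq]; simp
    constructor
    · rw [Set.mem_inter_iff, Metric.mem_ball, dist_eq_norm, ← hn,
        pow_lt_pow_iff_left₀ (norm_nonneg _) hδ.le two_ne_zero]
      exact and_iff_left hy
    · rw [hF x, hF ⟨_, hy⟩, linearForm_apply, ← hn, ← mul_pow, ← sq_abs (_ - _ - _),
        pow_le_pow_iff_left₀ (abs_nonneg _) (by positivity) two_ne_zero, Real.norm_eq_abs]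
      simp
  constructor
  · rintro h y u ⟨hy, rfl⟩ hyδ
    exact (key y hy).2.1 (h ((key y hy).1.2 hyδ))
  · intro h y hy
    exact (key y.ofLp hy.2).2.2 (h _ _ ⟨hy.2, rfl⟩ ((key y.ofLp hy.2).1.1 hy))

/-- The derivative of a Nash function along a polynomial vector field is a Nash function. -/
lemma IsNashFun.derivFun {X : SmoothVectorField M} (hX : ∀ i, IsPolynomialFun fun x => X.toFun x i)
    {φ : SmoothFun M} (hφ : IsNashFun φ.1) : IsNashFun (X.derivFun φ) := by
  classical
  refine ⟨X.derivFun_mem φ, isSemialgebraicFun_iff.2 ?_⟩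
  choose p hp using hX
  let F : EuclideanSpace ℝ (Fin n) → ℝ := fun y => if h : y ∈ M then φ.1 ⟨y, h⟩ else 0
  have hF : ∀ y : M, F y = φ.1 y := fun y => dif_pos y.2
  -- The derivative is defined by a first-order formula: some linear form `ℓ` is a differential
  -- along `M`, in terms of ε and δ, and its value on the field is the last coordinate. Such an `ℓ`
  -- need not be unique, but all of them agree on tangent vectors.
  refine SemialgPred.congr (ι := Fin (n + 1))
    (P := fun z => ∃ (ℓ : Fin n → ℝ) (a : ℝ), GraphRel φ.1 (fun i => z i.castSucc) a ∧
      (∀ ε : ℝ, 0 < ε → ∃ δ : ℝ, 0 < δ ∧ ∀ (y : Fin n → ℝ) (u : ℝ), GraphRel φ.1 y u →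
        ∑ i, (y i - z (Fin.castSucc i)) ^ 2 < δ ^ 2 →
          (u - a - ∑ i, ℓ i * (y i - z (Fin.castSucc i))) ^ 2 ≤
            ε ^ 2 * ∑ i, (y i - z (Fin.castSucc i)) ^ 2) ∧
      ∑ i, ℓ i * polyEval (p i) (WithLp.toLp 2 fun i => z i.castSucc) = z (Fin.last n)) ?_ ?_
  · refine .exists_vec (.exists_real (.and (hφ.2.comp (fun i => .coord _) (.coord _)) (.and ?_ ?_)))
    · refine .forall_real (.imp (.lt (.const 0) (.coord _)) (.exists_real
        (.and (.lt (.const 0) (.coord _)) (.forall_vec (.forall_real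
          (.imp (hφ.2.comp (fun i => .coord _) (.coord _)) (.imp ?_ ?_)))))))
      · exact .lt (.sum fun i => .pow (.sub (.coord _) (.coord _)) 2) (.pow (.coord _) 2)
      · exact .le (.pow (.sub (.sub (.coord _) (.coord _))
          (.sum fun i => .mul (.coord _) (.sub (.coord _) (.coord _)))) 2)
          (.mul (.pow (.coord _) 2) (.sum fun i => .pow (.sub (.coord _) (.coord _)) 2))
    · exact .eq (.sum fun i => .mul (.coord _) (.polyEval_comp (fun i => .coord _) (p i))) (.coord _)
  · intro z
    have hval : ∀ (h : WithLp.toLp 2 (fun i => z (Fin.castSucc i)) ∈ M) (ℓ : Fin n → ℝ),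
        HasFDerivWithinAt F (linearForm ℓ) M (WithLp.toLp 2 fun i => z (Fin.castSucc i)) →
        X.derivFun φ ⟨_, h⟩ =
          ∑ i, ℓ i * polyEval (p i) (WithLp.toLp 2 fun i => z i.castSucc) := by
      intro h ℓ hℓ
      rw [X.derivFun_eq_of_hasFDerivWithinAt φ ⟨_, h⟩ hF hℓ, linearForm_apply]
      exact Finset.sum_congr rfl fun i _ => by rw [← hp i ⟨_, h⟩]
    constructor
    · rintro ⟨h, h'⟩
      obtain ⟨g, hg⟩ := φ.2 ⟨_, h⟩
      obtain ⟨ℓ, hℓ⟩ := exists_linearForm_eq (fderiv ℝ g (WithLp.toLp 2 fun i => z i.castSucc))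
      have hd : HasFDerivWithinAt F (linearForm ℓ) M
          (WithLp.toLp 2 fun i => z (Fin.castSucc i)) := by
        rw [← hℓ]
        have hev : F =ᶠ[𝓝[M] (WithLp.toLp 2 fun i => z (Fin.castSucc i))] g := by
          change ∀ᶠ y in 𝓝[M] ((⟨_, h⟩ : M) : EuclideanSpace ℝ (Fin n)), F y = g y
          rw [← map_nhds_subtype_val]
          exact Filter.eventually_map.2 (hg.2.mono fun y h => (hF y).trans h)
        exact (((hg.1.differentiable (by simp)) _).hasFDerivAt.hasFDerivWithinAt).congr_of_eventuallyEq
          hev (hev.self_of_nhdsWithin h)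
      exact ⟨ℓ, _, ⟨h, rfl⟩, (hasFDerivWithinAt_linearForm_iff hF ⟨_, h⟩ ℓ).1 hd,
        by rw [← hval h ℓ hd, h']⟩
    · rintro ⟨ℓ, a, ⟨h, rfl⟩, hd, h'⟩
      exact ⟨h, by rw [hval h ℓ ((hasFDerivWithinAt_linearForm_iff hF ⟨_, h⟩ ℓ).2 hd), h']⟩

end NashFunctions

/-! ### Projection onto the kernel of a matrix, without denominators -/

section TangentProjection
open Matrix

variable {m n R S : Type*} [Fintype m] [Fintype n] [DecidableEq m] [DecidableEq n] [CommRing R]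
  [CommRing S]

/-- The orthogonal projection onto the kernel of a matrix, multiplied by the Gram determinant of the
rows. -/
noncomputable def Matrix.kernelProjection (A : Matrix m n R) : Matrix n n R :=
  (A * Aᵀ).det • 1 - Aᵀ * (A * Aᵀ).adjugate * A

lemma Matrix.mul_kernelProjection (A : Matrix m n R) : A * A.kernelProjection = 0 := by
  rw [kernelProjection, Matrix.mul_sub, ← Matrix.mul_assoc, ← Matrix.mul_assoc, mul_adjugate]
  simp

lemma Matrix.kernelProjection_mulVec {A : Matrix m n R} {v : n → R} (hv : A *ᵥ v = 0) :
    A.kernelProjection *ᵥ v = (A * Aᵀ).det • v := by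
  rw [kernelProjection, sub_mulVec, ← mulVec_mulVec, hv]
  simp [smul_mulVec]

/-- Allows the projection to be formed over the polynomial ring and evaluated at points afterwards.
-/
lemma Matrix.kernelProjection_map (A : Matrix m n R) (φ : R →+* S) :
    A.kernelProjection.map φ = (A.map φ).kernelProjection := by
  have h1 : (A * Aᵀ).map φ = A.map φ * (A.map φ)ᵀ := by
    rw [Matrix.map_mul, transpose_map]
  have hdet : φ (A * Aᵀ).det = (A.map φ * (A.map φ)ᵀ).det := by
    rw [← h1, RingHom.map_det, RingHom.mapMatrix_apply]
  have hadj : ((A * Aᵀ).adjugate).map φ = (A.map φ * (A.map φ)ᵀ).adjugate := by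
    rw [← h1]
    exact RingHom.map_adjugate φ _
  have h2 : (Aᵀ * (A * Aᵀ).adjugate * A).map φ =
      (A.map φ)ᵀ * (A.map φ * (A.map φ)ᵀ).adjugate * A.map φ := by
    rw [Matrix.map_mul, Matrix.map_mul, hadj, transpose_map]
  ext i j
  have h2' := congrFun (congrFun h2 i) j
  rw [Matrix.map_apply] at h2'
  have h1 : φ ((1 : Matrix n n R) i j) = (1 : Matrix n n S) i j := by
    rw [Matrix.one_apply, Matrix.one_apply]
    split_ifs <;> simp
  rw [Matrix.map_apply, kernelProjection, kernelProjection, Matrix.sub_apply, Matrix.sub_apply,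
    map_sub, h2', Matrix.smul_apply, Matrix.smul_apply, smul_eq_mul, smul_eq_mul, map_mul, hdet, h1]

/-- If `A Aᵀ w = 0`, then `Aᵀ w` has zero norm, and `w` is a linear relation between the rows. -/
lemma Matrix.det_mul_transpose_ne_zero {p q : Type*} [Fintype p] [Fintype q] [DecidableEq p]
    {A : Matrix p q ℝ} (hA : LinearIndependent ℝ A) :
    (A * Aᵀ).det ≠ 0 := by
  intro h0
  obtain ⟨w, hw, hw0⟩ := Matrix.exists_mulVec_eq_zero_iff.2 h0
  have h1 : Aᵀ *ᵥ w = 0 := by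
    rw [← mulVec_mulVec] at hw0
    have h2 : (Aᵀ *ᵥ w) ⬝ᵥ (Aᵀ *ᵥ w) = 0 := by
      rw [dotProduct_mulVec, vecMul_transpose, hw0, zero_dotProduct]
    exact dotProduct_self_eq_zero.1 h2
  refine hw (funext fun i => Fintype.linearIndependent_iff.1 hA w ?_ i)
  ext j
  have := congrFun h1 j
  simpa [mulVec, dotProduct, Finset.sum_apply, mul_comm] using this

end TangentProjection

/-! ### Tangent vectors and the kernel of the Jacobian -/

section TangentCone
open Matrix

variable {n : ℕ} {M : Set (EuclideanSpace ℝ (Fin n))}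

/-- The Jacobian matrix of a finite family of polynomials. -/
noncomputable def jacobian {c : ℕ} (f : Fin c → MvPolynomial (Fin n) ℝ) :
    Matrix (Fin c) (Fin n) (MvPolynomial (Fin n) ℝ) :=
  Matrix.of fun i j => MvPolynomial.pderiv j (f i)

/-- The Jacobian matrix at a point. -/
noncomputable def jacobianAt {c : ℕ} (f : Fin c → MvPolynomial (Fin n) ℝ)
    (x : EuclideanSpace ℝ (Fin n)) : Matrix (Fin c) (Fin n) ℝ :=
  (jacobian f).map (MvPolynomial.eval x.ofLp)

lemma jacobianAt_mulVec {c : ℕ} (f : Fin c → MvPolynomial (Fin n) ℝ)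
    (x v : EuclideanSpace ℝ (Fin n)) (i : Fin c) :
    (jacobianAt f x *ᵥ v.ofLp) i = polyDifferential (f i) x v := by
  rw [polyDifferential_apply]
  rfl

/-- The differential of a polynomial that vanishes on `M` vanishes on tangent vectors. -/
lemma polyDifferential_eq_zero {p : MvPolynomial (Fin n) ℝ} (hp : ∀ y ∈ M, polyEval p y = 0)
    {x : EuclideanSpace ℝ (Fin n)} (hx : x ∈ M) {v : EuclideanSpace ℝ (Fin n)}
    (hv : v ∈ tangentConeAt ℝ M x) : polyDifferential p x v = 0 := by
  have h1 := (hasStrictFDerivAt_polyEval p x).hasFDerivAt.hasFDerivWithinAt (s := M)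
  have h2 : HasFDerivWithinAt (polyEval p) (0 : EuclideanSpace ℝ (Fin n) →L[ℝ] ℝ) M x :=
    (hasFDerivWithinAt_const (0 : ℝ) x M).congr hp (hp x hx)
  exact h1.unique_on h2 hv

/-- Near a point at which the Jacobian matrix of `f` has independent rows, the kernel of the Jacobian
matrix is tangent to every set that contains the zeros of `f`. -/
lemma mem_tangentConeAt_of_jacobianAt {c : ℕ} {f : Fin c → MvPolynomial (Fin n) ℝ}
    {x : EuclideanSpace ℝ (Fin n)} (hfx : ∀ i, polyEval (f i) x = 0)
    (hM : ∀ᶠ y in 𝓝 x, (∀ i, polyEval (f i) y = 0) → y ∈ M)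
    (hdet : (jacobianAt f x * (jacobianAt f x)ᵀ).det ≠ 0) {v : EuclideanSpace ℝ (Fin n)}
    (hv : jacobianAt f x *ᵥ v.ofLp = 0) : v ∈ tangentConeAt ℝ M x := by
  let Φ : EuclideanSpace ℝ (Fin n) → Fin c → ℝ := fun y i => polyEval (f i) y
  let Φ' : EuclideanSpace ℝ (Fin n) →L[ℝ] Fin c → ℝ :=
    ContinuousLinearMap.pi fun i => polyDifferential (f i) x
  have hΦ : HasStrictFDerivAt Φ Φ' x :=
    hasStrictFDerivAt_pi.2 fun i => hasStrictFDerivAt_polyEval (f i) x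
  have happ : ∀ u, Φ' u = jacobianAt f x *ᵥ u.ofLp := fun u =>
    funext fun i => (jacobianAt_mulVec f x u i).symm
  have hsurj : (Φ' : EuclideanSpace ℝ (Fin n) →ₗ[ℝ] Fin c → ℝ).range = ⊤ := by
    refine LinearMap.range_eq_top.2 fun u => ?_
    -- `Aᵀ (A Aᵀ)⁻¹` is a right inverse of the Jacobian matrix `A`.
    refine ⟨WithLp.toLp 2 ((jacobianAt f x)ᵀ *ᵥ
      ((jacobianAt f x * (jacobianAt f x)ᵀ)⁻¹ *ᵥ u)), ?_⟩
    refine (happ _).trans ?_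
    rw [mulVec_mulVec, mulVec_mulVec, Matrix.mul_nonsing_inv _ (isUnit_iff_ne_zero.2 hdet),
      one_mulVec]
  have hΦx : Φ x = 0 := funext hfx
  let k : (Φ' : EuclideanSpace ℝ (Fin n) →ₗ[ℝ] Fin c → ℝ).ker :=
    ⟨v, LinearMap.mem_ker.2 ((happ v).trans hv)⟩
  -- A curve through `x` with velocity `v` that stays in the zero set of `f` for small `t`, hence in
  -- `M`.
  let γ : ℝ → EuclideanSpace ℝ (Fin n) := fun t =>
    HasStrictFDerivAt.implicitFunction Φ Φ' hΦ hsurj (Φ x) (t • k)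
  have hγ0 : γ 0 = x := by
    simp [γ]
  have hline : HasDerivAt (fun t : ℝ => t • k) k 0 := by
    simpa using (hasDerivAt_id (0 : ℝ)).smul_const k
  have hγ : HasDerivAt γ v 0 := by
    have h1 := (hΦ.to_implicitFunction hsurj).hasFDerivAt
    rw [← zero_smul ℝ k] at h1
    exact h1.comp_hasDerivAt (0 : ℝ) hline
  have hcont : Tendsto (fun t : ℝ => γ t - x) (𝓝[≠] 0) (𝓝 0) := by
    have := hγ.continuousAt.tendsto.sub_const x
    rw [hγ0, sub_self] at this
    exact this.mono_left nhdsWithin_le_nhds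
  refine mem_tangentConeAt_of_seq (𝓝[≠] (0 : ℝ)) (fun t => t⁻¹) (fun t => γ t - x) hcont ?_ ?_
  · have h1 : ∀ᶠ t in 𝓝 (0 : ℝ), Φ (γ t) = Φ x := by
      have h2 : Tendsto (fun t : ℝ => (Φ x, t • k)) (𝓝 0) (𝓝 (Φ x, 0)) := by
        refine tendsto_const_nhds.prodMk_nhds ?_
        simpa using hline.continuousAt.tendsto
      exact h2.eventually (hΦ.map_implicitFunction_eq hsurj)
    have h2 : ∀ᶠ t in 𝓝 (0 : ℝ), (∀ i, polyEval (f i) (γ t) = 0) → γ t ∈ M := by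
      have := hγ.continuousAt.tendsto
      rw [hγ0] at this
      exact this.eventually hM
    refine Filter.Eventually.filter_mono nhdsWithin_le_nhds ?_
    filter_upwards [h1, h2] with t ht1 ht2
    rw [add_sub_cancel]
    rw [hΦx] at ht1
    exact ht2 fun i => congrFun ht1 i
  · have := hγ.tendsto_slope_zero
    simpa [hγ0] using this

end TangentCone

/-! ### Generation of Nash vector fields by polynomial ones -/

section PolynomialFrames
open Matrix

variable {n : ℕ} {M : Set (EuclideanSpace ℝ (Fin n))}

/-- The vectors `X j` of polynomials are tangent to `M`, and their combination with the components
of a tangent vector `v` as coefficients is `w • v`. -/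
structure IsTangentFrame (M : Set (EuclideanSpace ℝ (Fin n))) (w : MvPolynomial (Fin n) ℝ)
    (X : Fin n → Fin n → MvPolynomial (Fin n) ℝ) : Prop where
  tangent : ∀ j, ∀ y ∈ M, WithLp.toLp 2 (fun i => polyEval (X j i) y) ∈ tangentConeAt ℝ M y
  span : ∀ y ∈ M, ∀ v ∈ tangentConeAt ℝ M y, ∀ i,
    ∑ j, v j * polyEval (X j i) y = polyEval w y * v i

/-- The fields are the columns of the kernel projection of the Jacobian, multiplied by `h * D` with
`D` the Gram determinant. This factor kills them at the points of `M` where `h` vanishes or the rows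
become dependent, so they are tangent to all of `M`. The projection scales tangent vectors by `D`,
whence `w = h * D * D`. -/
lemma IsNonsingularAt.exists_tangentFrame {x : EuclideanSpace ℝ (Fin n)}
    (h : IsNonsingularAt M x) : ∃ w X, IsTangentFrame M w X ∧ polyEval w x ≠ 0 := by
  obtain ⟨c, f, h, hf, hli, hhx, hzero⟩ := h
  set D := (jacobian f * (jacobian f)ᵀ).det with hD
  have hDy : ∀ y, polyEval D y = (jacobianAt f y * (jacobianAt f y)ᵀ).det := by
    intro y
    have h1 : (jacobian f * (jacobian f)ᵀ).map (MvPolynomial.eval y.ofLp) =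
        jacobianAt f y * (jacobianAt f y)ᵀ := by
      rw [Matrix.map_mul, transpose_map]; rfl
    rw [← h1]
    exact RingHom.map_det _ _
  have hPy : ∀ y i j, polyEval ((jacobian f).kernelProjection i j) y =
      (jacobianAt f y).kernelProjection i j := by
    intro y i j
    exact congrFun (congrFun (Matrix.kernelProjection_map (jacobian f)
      (MvPolynomial.eval y.ofLp)) i) j
  refine ⟨h * D * D, fun j i => h * D * (jacobian f).kernelProjection i j, ⟨?_, ?_⟩, ?_⟩
  · intro j y hy
    by_cases h0 : polyEval h y * polyEval D y = 0
    · have : WithLp.toLp 2 (fun i => polyEval (h * D * (jacobian f).kernelProjection i j) y) =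
          (0 : EuclideanSpace ℝ (Fin n)) := by
        ext i
        simp [polyEval_mul, h0]
      rw [this]
      exact zero_mem_tangentConeAt (subset_closure hy)
    · have hh : polyEval h y ≠ 0 := left_ne_zero_of_mul h0
      refine mem_tangentConeAt_of_jacobianAt (f := f) (fun i => hf i y hy) ?_
        ((hDy y) ▸ right_ne_zero_of_mul h0) ?_
      · filter_upwards [(continuous_polyEval h).continuousAt.eventually_ne hh] with z hz
        exact hzero z hz
      · have hcol : (fun i => polyEval (h * D * (jacobian f).kernelProjection i j) y) =
            (polyEval h y * polyEval D y) •
              ((jacobianAt f y).kernelProjection *ᵥ Pi.single j 1) := by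
          ext i
          simp [polyEval_mul, hPy]
        rw [hcol, mulVec_smul, mulVec_mulVec, Matrix.mul_kernelProjection, zero_mulVec, smul_zero]
  · intro y hy v hv i
    have hker : jacobianAt f y *ᵥ v.ofLp = 0 := funext fun i =>
      (jacobianAt_mulVec f y v i).trans (polyDifferential_eq_zero (hf i) hy hv)
    have := congrFun (Matrix.kernelProjection_mulVec hker) i
    rw [← hDy, mulVec, dotProduct, Pi.smul_apply, smul_eq_mul] at this
    simp only [polyEval_mul, hPy]
    rw [mul_assoc (polyEval h y * polyEval D y), ← this, Finset.mul_sum]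
    exact Finset.sum_congr rfl fun j _ => by ring
  · rw [polyEval_mul, polyEval_mul, hDy]
    have := Matrix.det_mul_transpose_ne_zero (A := jacobianAt f x) hli
    exact mul_ne_zero (mul_ne_zero hhx this) this

/-- Finitely many tangent frames, of which at least one spans at each point of `M`. -/
lemma IsSmoothRealAffineVariety.exists_finset_tangentFrame (hM : IsSmoothRealAffineVariety M) :
    ∃ T : Finset (MvPolynomial (Fin n) ℝ), (∀ w ∈ T, ∃ X, IsTangentFrame M w X) ∧
      ∀ x ∈ M, ∃ w ∈ T, polyEval w x ≠ 0 := by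
  set W : Set (MvPolynomial (Fin n) ℝ) := {w | ∃ X, IsTangentFrame M w X}
  -- The ideal generated by all the multipliers `w` is generated by finitely many of them; a common
  -- zero of these would be a zero of every multiplier.
  obtain ⟨T, hTW, hT⟩ := (Submodule.fg_span_iff_fg_span_finset_subset W).1
    (IsNoetherian.noetherian (Ideal.span W))
  refine ⟨T, fun w hw => hTW hw, fun x hx => ?_⟩
  by_contra! hno
  obtain ⟨w, X, hX, hwx⟩ := (hM.nonsingular x hx).exists_tangentFrame
  have hle : Ideal.span (T : Set (MvPolynomial (Fin n) ℝ)) ≤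
      RingHom.ker (MvPolynomial.eval x.ofLp) := Ideal.span_le.2 fun p hp => hno p hp
  have hw : w ∈ Ideal.span (T : Set (MvPolynomial (Fin n) ℝ)) := by
    have := Ideal.subset_span (show w ∈ W from ⟨X, hX⟩)
    rwa [Ideal.span, hT] at this
  exact hwx (hle hw)

/-- The derivative along a vector field is linear in the vector field. -/
lemma SmoothVectorField.derivFun_eq_sum {κ : Type*} [Fintype κ] {Y : SmoothVectorField M}
    {X : κ → SmoothVectorField M} {x : M} {c : κ → ℝ}
    (h : ∀ i, Y.toFun x i = ∑ k, c k * (X k).toFun x i) (φ : SmoothFun M) :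
    Y.derivFun φ x = ∑ k, c k * (X k).derivFun φ x := by
  obtain ⟨g, hg⟩ := φ.2 x
  have hY : Y.toFun x = ∑ k, c k • (X k).toFun x := by
    ext i
    simp [h i]
  rw [Y.derivFun_eq φ x hg, hY, map_sum]
  exact Finset.sum_congr rfl fun k _ => by
    rw [(X k).derivFun_eq φ x hg, map_smul, smul_eq_mul]

/-- Nash vector fields are combinations of finitely many polynomial vector fields with Nash
functions as coefficients. -/
theorem IsSmoothRealAffineVariety.exists_generating_vectorFields
    (hM : IsSmoothRealAffineVariety M) :
    ∃ (κ : Type) (_ : Fintype κ) (X : κ → SmoothVectorField M),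
      (∀ k i, IsPolynomialFun fun x => (X k).toFun x i) ∧
      ∀ Y : SmoothVectorField M, (∀ i, IsNashFun fun x => Y.toFun x i) →
        ∃ c : κ → SmoothFun M, (∀ k, IsNashFun (c k).1) ∧
          Y.derivation = ∑ k, LinearMap.mulLeft ℝ (c k) * (X k).derivation := by
  obtain ⟨T, hT, hTx⟩ := hM.exists_finset_tangentFrame
  choose X hX using fun w : T => hT w.1 w.2
  have hpoly : ∀ (k : T × Fin n) i, IsPolynomialFun fun x : M =>
      (WithLp.toLp 2 fun i => polyEval (X k.1 k.2 i) x : EuclideanSpace ℝ (Fin n)) i :=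
    fun k i => ⟨X k.1 k.2 i, fun x => rfl⟩
  let F : T × Fin n → SmoothVectorField M := fun k =>
    { toFun := fun x => WithLp.toLp 2 fun i => polyEval (X k.1 k.2 i) x
      smooth := fun i => (hpoly k i).mem_smoothFun
      tangent := fun x => (hX k.1).tangent k.2 x x.2 }
  refine ⟨T × Fin n, inferInstance, F, hpoly, fun Y hY => ?_⟩
  -- The frame of `w` combines to `w • Y`. Weighting by `w`, summing, and dividing by `W`, which has
  -- no zero on `M`, recovers `Y`.
  set W : MvPolynomial (Fin n) ℝ := ∑ w : T, w.1 ^ 2 with hWdef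
  have hWx : ∀ x, polyEval W x = ∑ w : T, polyEval w.1 x ^ 2 := fun x => by
    rw [hWdef, polyEval_sum]
    exact Finset.sum_congr rfl fun w _ => polyEval_pow _ _ _
  have hW : ∀ x ∈ M, polyEval W x ≠ 0 := by
    intro x hx
    obtain ⟨w, hw, hwx⟩ := hTx x hx
    rw [hWx]
    refine (Finset.sum_pos' (fun w _ => sq_nonneg _) ⟨⟨w, hw⟩, Finset.mem_univ _, ?_⟩).ne'
    change 0 < polyEval w x ^ 2
    positivity
  have hc : ∀ k : T × Fin n, IsNashFun ((fun x : M => (polyEval W x)⁻¹) *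
      ((fun x : M => polyEval k.1.1 x) * fun x : M => Y.toFun x k.2)) := fun k =>
    (IsNashFun.inv_polyEval hM hW).mul
      ((IsPolynomialFun.isNashFun hM ⟨k.1.1, fun _ => rfl⟩).mul (hY k.2))
  refine ⟨fun k => ⟨_, (hc k).1⟩, hc, ?_⟩
  refine LinearMap.ext fun φ => Subtype.ext (funext fun x => ?_)
  have hsum : ((∑ k, LinearMap.mulLeft ℝ (⟨_, (hc k).1⟩ : SmoothFun M) * (F k).derivation) φ).1 x =
      ∑ k, ((polyEval W x)⁻¹ * (polyEval k.1.1 x * Y.toFun x k.2)) * (F k).derivFun φ x := by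
    rw [LinearMap.sum_apply, AddSubmonoidClass.coe_finsetSum, Finset.sum_apply]
    rfl
  rw [hsum]
  refine SmoothVectorField.derivFun_eq_sum (fun i => ?_) φ
  rw [Fintype.sum_prod_type]
  have hw : ∀ w : T, ∑ j, (polyEval W x)⁻¹ * (polyEval w.1 x * Y.toFun x j) *
      (F (w, j)).toFun x i = (polyEval W x)⁻¹ * polyEval w.1 x ^ 2 * Y.toFun x i := by
    intro w
    have := (hX w).span x x.2 _ (Y.tangent x) i
    rw [pow_two, ← mul_assoc, mul_assoc (_ * _) (polyEval w.1 x), ← this, Finset.mul_sum]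
    exact Finset.sum_congr rfl fun j _ => by
      change _ * _ * polyEval (X w j i) x = _
      ring
  rw [Finset.sum_congr rfl fun w _ => hw w, ← Finset.sum_mul, ← Finset.mul_sum, ← hWx,
    inv_mul_cancel₀ (hW x x.2), one_mul]

end PolynomialFrames

/-! ### Nash operators in terms of algebraic operators, and the equality of the two spaces -/

section DifferentialOperators

variable {n : ℕ} {M : Set (EuclideanSpace ℝ (Fin n))}

lemma SmoothVectorField.derivation_mul_mulLeft (X : SmoothVectorField M) (f : SmoothFun M) :
    X.derivation * LinearMap.mulLeft ℝ f =
      LinearMap.mulLeft ℝ (X.derivation f) + LinearMap.mulLeft ℝ f * X.derivation := by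
  refine LinearMap.ext fun φ => Subtype.ext (funext fun x => ?_)
  obtain ⟨g, hg⟩ := f.2 x
  obtain ⟨h, hh⟩ := φ.2 x
  change X.derivFun (f * φ) x = X.derivFun f x * φ.1 x + f.1 x * X.derivFun φ x
  rw [X.derivFun_eq f x hg, X.derivFun_eq φ x hh, X.derivFun_eq (f * φ) x (hg.op₂ hh).2,
    fderiv_mul ((hg.1.differentiable (by simp)) _) ((hh.1.differentiable (by simp)) _),
    hg.2.self_of_nhds, hh.2.self_of_nhds]
  simp only [add_apply, smul_apply, smul_eq_mul]
  ring

/-- The linear combinations of algebraic differential operators with Nash functions as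
coefficients. -/
def nashSpan (M : Set (EuclideanSpace ℝ (Fin n))) : Submodule ℝ (Module.End ℝ (SmoothFun M)) :=
  Submodule.span ℝ {E | ∃ f : SmoothFun M, IsNashFun f.1 ∧ ∃ D ∈ algebraicDiffOp M,
    E = LinearMap.mulLeft ℝ f * D}

lemma mulLeft_mul_mem_nashSpan {f : SmoothFun M} (hf : IsNashFun f.1)
    {E : Module.End ℝ (SmoothFun M)} (hE : E ∈ nashSpan M) :
    LinearMap.mulLeft ℝ f * E ∈ nashSpan M := by
  induction hE using Submodule.span_induction with
  | mem E hE =>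
    obtain ⟨g, hg, D, hD, rfl⟩ := hE
    refine Submodule.subset_span ⟨f * g, hf.mul hg, D, hD, ?_⟩
    rw [← mul_assoc, LinearMap.mulLeft_mul]
    rfl
  | zero => rw [mul_zero]; exact zero_mem _
  | add E F _ _ hE hF => rw [mul_add]; exact add_mem hE hF
  | smul r E _ hE => rw [mul_smul_comm]; exact Submodule.smul_mem _ r hE

/-- By the Leibniz rule, moving `X` past a Nash coefficient `g` costs a term with coefficient `X g`,
which is again Nash because `X` is polynomial. -/
lemma derivation_mul_mem_nashSpan {X : SmoothVectorField M}
    (hX : ∀ i, IsPolynomialFun fun x => X.toFun x i) {E : Module.End ℝ (SmoothFun M)}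
    (hE : E ∈ nashSpan M) : X.derivation * E ∈ nashSpan M := by
  induction hE using Submodule.span_induction with
  | mem E hE =>
    obtain ⟨g, hg, D, hD, rfl⟩ := hE
    rw [← mul_assoc, X.derivation_mul_mulLeft, add_mul, mul_assoc]
    refine add_mem (Submodule.subset_span ⟨_, hg.derivFun hX, D, hD, rfl⟩)
      (Submodule.subset_span ⟨g, hg, _, mul_mem (Algebra.subset_adjoin ?_) hD, rfl⟩)
    exact Or.inr ⟨X, hX, rfl⟩
  | zero => rw [mul_zero]; exact zero_mem _
  | add E F _ _ hE hF => rw [mul_add]; exact add_mem hE hF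
  | smul r E _ hE => rw [mul_smul_comm]; exact Submodule.smul_mem _ r hE

/-- Nash differential operators are combinations of algebraic ones. -/
theorem IsSmoothRealAffineVariety.nashDiffOp_subset_nashSpan (hM : IsSmoothRealAffineVariety M)
    {D : Module.End ℝ (SmoothFun M)} (hD : D ∈ nashDiffOp M) : D ∈ nashSpan M := by
  -- Stability of `nashSpan M` under left multiplication by `D` passes to products of operators,
  -- unlike mere membership of `D`.
  suffices H : ∀ E ∈ nashSpan M, D * E ∈ nashSpan M by
    have h1 : (1 : Module.End ℝ (SmoothFun M)) ∈ nashSpan M :=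
      Submodule.subset_span ⟨1, IsPolynomialFun.isNashFun hM ⟨1, fun x => (polyEval_one _).symm⟩,
        1, one_mem _, by rw [mul_one]; exact (LinearMap.mulLeft_one ℝ _).symm⟩
    simpa using H 1 h1
  induction hD using Algebra.adjoin_induction with
  | mem D hD =>
    intro E hE
    rcases hD with ⟨f, hf, rfl⟩ | ⟨Y, hY, rfl⟩
    · exact mulLeft_mul_mem_nashSpan hf hE
    · obtain ⟨κ, _, X, hX, H⟩ := hM.exists_generating_vectorFields
      obtain ⟨c, hc, h⟩ := H Y hY
      rw [h, Finset.sum_mul]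
      refine sum_mem fun k _ => ?_
      rw [mul_assoc]
      exact mulLeft_mul_mem_nashSpan (hc k) (derivation_mul_mem_nashSpan (hX k) hE)
  | algebraMap r =>
    intro E hE
    rw [← Algebra.smul_def]
    exact Submodule.smul_mem _ r hE
  | add A B _ _ hA hB =>
    intro E hE
    rw [add_mul]
    exact add_mem (hA E hE) (hB E hE)
  | mul A B _ _ hA hB =>
    intro E hE
    rw [mul_assoc]
    exact hA _ (hB E hE)

lemma IsSmoothRealAffineVariety.algebraicDiffOp_le (hM : IsSmoothRealAffineVariety M) :
    algebraicDiffOp M ≤ nashDiffOp M := by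
  refine Algebra.adjoin_mono (Set.union_subset_union ?_ ?_)
  · rintro _ ⟨f, hf, rfl⟩
    exact ⟨f, hf.isNashFun hM, rfl⟩
  · rintro _ ⟨X, hX, rfl⟩
    exact ⟨X, fun i => (hX i).isNashFun hM, rfl⟩

/-- The square of the distance from the origin, as a polynomial. -/
noncomputable def normSqPoly (n : ℕ) : MvPolynomial (Fin n) ℝ := ∑ i, MvPolynomial.X i ^ 2

lemma polyEval_normSqPoly (x : EuclideanSpace ℝ (Fin n)) :
    polyEval (normSqPoly n) x = ‖x‖ ^ 2 := by
  rw [normSqPoly, polyEval_sum, EuclideanSpace.real_norm_sq_eq]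
  exact Finset.sum_congr rfl fun i _ => by rw [polyEval_pow, polyEval_X]

/-- The functions all of whose algebraic derivatives are bounded. -/
def algebraicSchwartzFun (M : Set (EuclideanSpace ℝ (Fin n))) : Set (SmoothFun M) :=
  {φ | ∀ D ∈ algebraicDiffOp M, ∃ C : ℝ, ∀ x : M, |(D φ).1 x| ≤ C}

lemma apply_mem_algebraicSchwartzFun {φ : SmoothFun M} (hφ : φ ∈ algebraicSchwartzFun M)
    {D : Module.End ℝ (SmoothFun M)} (hD : D ∈ algebraicDiffOp M) :
    D φ ∈ algebraicSchwartzFun M := fun E hE => hφ (E * D) (mul_mem hE hD)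

/-- Multiplication by `(1 + ‖x‖ ^ 2) ^ N` is itself an algebraic differential operator. -/
lemma exists_pow_mul_abs_le {φ : SmoothFun M} (hφ : φ ∈ algebraicSchwartzFun M) (N : ℕ) :
    ∃ C : ℝ, ∀ x : M, (1 + ‖x.1‖ ^ 2) ^ N * |φ.1 x| ≤ C := by
  have hq : IsPolynomialFun fun x : M => polyEval ((1 + normSqPoly n) ^ N) x :=
    ⟨_, fun _ => rfl⟩
  obtain ⟨C, hC⟩ := hφ (LinearMap.mulLeft ℝ ⟨_, hq.mem_smoothFun⟩)
    (Algebra.subset_adjoin (Or.inl ⟨_, hq, rfl⟩))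
  refine ⟨C, fun x => ?_⟩
  have h := hC x
  change |polyEval ((1 + normSqPoly n) ^ N) x.1 * φ.1 x| ≤ C at h
  rwa [polyEval_pow, polyEval_add, polyEval_one, polyEval_normSqPoly, abs_mul, abs_of_nonneg
    (by positivity)] at h

/-- The polynomial growth of a Nash coefficient is absorbed by the rapid decay of `D φ`. -/
lemma exists_abs_apply_le_of_mem_nashSpan (hM : IsClosed M) {φ : SmoothFun M}
    (hφ : φ ∈ algebraicSchwartzFun M) {E : Module.End ℝ (SmoothFun M)} (hE : E ∈ nashSpan M) :
    ∃ C : ℝ, ∀ x : M, |(E φ).1 x| ≤ C := by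
  induction hE using Submodule.span_induction with
  | mem E hE =>
    obtain ⟨f, hf, D, hD, rfl⟩ := hE
    obtain ⟨C, N, hC⟩ := hf.exists_abs_le hM
    obtain ⟨B, hB⟩ := exists_pow_mul_abs_le (apply_mem_algebraicSchwartzFun hφ hD) N
    refine ⟨|C| * B, fun x => ?_⟩
    change |f.1 x * (D φ).1 x| ≤ |C| * B
    calc |f.1 x * (D φ).1 x| = |f.1 x| * |(D φ).1 x| := abs_mul _ _
      _ ≤ |C| * (1 + ‖x.1‖ ^ 2) ^ N * |(D φ).1 x| := by
          refine mul_le_mul_of_nonneg_right ((hC x).trans ?_) (abs_nonneg _)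
          exact mul_le_mul_of_nonneg_right (le_abs_self C) (by positivity)
      _ = |C| * ((1 + ‖x.1‖ ^ 2) ^ N * |(D φ).1 x|) := mul_assoc _ _ _
      _ ≤ |C| * B := mul_le_mul_of_nonneg_left (hB x) (abs_nonneg _)
  | zero => exact ⟨0, fun x => by simp⟩
  | add E F _ _ hE hF =>
    obtain ⟨B, hB⟩ := hE
    obtain ⟨C, hC⟩ := hF
    exact ⟨B + C, fun x => (abs_add_le _ _).trans (add_le_add (hB x) (hC x))⟩
  | smul r E _ hE =>
    obtain ⟨B, hB⟩ := hE
    refine ⟨|r| * B, fun x => ?_⟩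
    change |r * (E φ).1 x| ≤ |r| * B
    rw [abs_mul]
    exact mul_le_mul_of_nonneg_left (hB x) (abs_nonneg r)

theorem IsSmoothRealAffineVariety.schwartzFun_eq (hM : IsSmoothRealAffineVariety M) :
    schwartzFun M = algebraicSchwartzFun M :=
  Set.Subset.antisymm (fun _ hφ D hD => hφ D (hM.algebraicDiffOp_le hD)) fun _ hφ _ hD =>
    exists_abs_apply_le_of_mem_nashSpan hM.isClosed hφ (hM.nashDiffOp_subset_nashSpan hD)

end DifferentialOperators

/-! ### Comparison with the classical Schwartz space -/

section ClassicalSchwartz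
open LineDeriv

variable {n : ℕ}

lemma isSmoothRealAffineVariety_univ :
    IsSmoothRealAffineVariety (Set.univ : Set (EuclideanSpace ℝ (Fin n))) where
  algebraic := ⟨∅, by simp⟩
  nonsingular x _ := ⟨0, Fin.elim0, 1, fun i => i.elim0, linearIndependent_empty_type, by simp,
    fun _ _ _ => Set.mem_univ _⟩

lemma hasTemperateGrowth_polyEval (p : MvPolynomial (Fin n) ℝ) :
    Function.HasTemperateGrowth (polyEval p) :=
  polyEval_induction (T := Function.HasTemperateGrowth) (fun c => .const c)
    (fun i => (EuclideanSpace.proj (𝕜 := ℝ) i).hasTemperateGrowth) (fun _ _ hf hg => hf.add hg)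
    (fun _ _ hf hg => hf.mul hg) p

/-- A smooth function on `ℝⁿ` as a function on `EuclideanSpace`. -/
def univFun (φ : SmoothFun (Set.univ : Set (EuclideanSpace ℝ (Fin n))))
    (x : EuclideanSpace ℝ (Fin n)) : ℝ :=
  φ.1 ⟨x, Set.mem_univ x⟩

lemma contDiff_univFun (φ : SmoothFun (Set.univ : Set (EuclideanSpace ℝ (Fin n)))) :
    ContDiff ℝ ∞ (univFun φ) := by
  rw [contDiff_iff_contDiffAt]
  intro x
  obtain ⟨g, hg, he⟩ := φ.2 ⟨x, Set.mem_univ x⟩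
  refine hg.contDiffAt.congr_of_eventuallyEq ?_
  have hc : Continuous fun y : EuclideanSpace ℝ (Fin n) =>
      (⟨y, Set.mem_univ y⟩ : (Set.univ : Set (EuclideanSpace ℝ (Fin n)))) := by fun_prop
  exact hc.continuousAt.eventually he

lemma isSmoothExtensionAt_univFun
    (φ : SmoothFun (Set.univ : Set (EuclideanSpace ℝ (Fin n))))
    (x : (Set.univ : Set (EuclideanSpace ℝ (Fin n)))) : IsSmoothExtensionAt φ.1 x (univFun φ) :=
  ⟨contDiff_univFun φ, Eventually.of_forall fun _ => rfl⟩

/-- The coordinate vector fields of `ℝⁿ`. -/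
noncomputable def coordField (i : Fin n) :
    SmoothVectorField (Set.univ : Set (EuclideanSpace ℝ (Fin n))) where
  toFun _ := EuclideanSpace.single i 1
  smooth j x := ⟨fun _ => (EuclideanSpace.single i (1 : ℝ) : EuclideanSpace ℝ (Fin n)) j,
    contDiff_const, Eventually.of_forall fun _ => rfl⟩
  tangent x := by rw [tangentConeAt_univ]; exact Set.mem_univ _

lemma coordField_derivation_mem (i : Fin n) :
    (coordField i).derivation ∈ algebraicDiffOp (Set.univ : Set (EuclideanSpace ℝ (Fin n))) :=
  Algebra.subset_adjoin (Or.inr ⟨coordField i, fun _ => ⟨MvPolynomial.C _, fun _ =>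
    (polyEval_C _ _).symm⟩, rfl⟩)

lemma univFun_coordField_derivation (i : Fin n)
    (φ : SmoothFun (Set.univ : Set (EuclideanSpace ℝ (Fin n)))) (x : EuclideanSpace ℝ (Fin n)) :
    univFun ((coordField i).derivation φ) x = fderiv ℝ (univFun φ) x (EuclideanSpace.single i 1) :=
  (coordField i).derivFun_eq φ ⟨x, Set.mem_univ x⟩ (isSmoothExtensionAt_univFun φ _)

/-- Induction on `m` for all `φ` at once: the differential of `φ` is a sum of partial derivatives
times constant forms, and partial derivatives remain in `algebraicSchwartzFun`. -/
lemma exists_pow_mul_norm_iteratedFDeriv_le (m : ℕ)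
    {φ : SmoothFun (Set.univ : Set (EuclideanSpace ℝ (Fin n)))}
    (hφ : φ ∈ algebraicSchwartzFun Set.univ) (k : ℕ) :
    ∃ C : ℝ, ∀ x, ‖x‖ ^ k * ‖iteratedFDeriv ℝ m (univFun φ) x‖ ≤ C := by
  induction m generalizing φ with
  | zero =>
    obtain ⟨C, hC⟩ := exists_pow_mul_abs_le hφ k
    refine ⟨C, fun x => le_trans ?_ (hC ⟨x, Set.mem_univ x⟩)⟩
    rw [norm_iteratedFDeriv_zero, Real.norm_eq_abs]
    refine mul_le_mul_of_nonneg_right (pow_le_pow_left₀ (norm_nonneg _) ?_ _) (abs_nonneg _)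
    nlinarith [sq_nonneg (‖x‖ - 1), norm_nonneg x]
  | succ m ih =>
    choose C hC using fun i : Fin n =>
      ih (apply_mem_algebraicSchwartzFun hφ (coordField_derivation_mem i))
    let L : Fin n → ℝ →L[ℝ] (EuclideanSpace ℝ (Fin n) →L[ℝ] ℝ) := fun i =>
      ContinuousLinearMap.toSpanSingleton ℝ (EuclideanSpace.proj i)
    let g : Fin n → EuclideanSpace ℝ (Fin n) → ℝ := fun i =>
      univFun ((coordField i).derivation φ)
    have hg : ∀ i, ContDiff ℝ ∞ (g i) := fun i => contDiff_univFun _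
    have hfd : fderiv ℝ (univFun φ) = fun x => ∑ i, (L i ∘ g i) x := by
      funext x
      ext v
      have hdec : v = ∑ i, v i • EuclideanSpace.single i (1 : ℝ) := by
        ext j
        simp [Finset.sum_apply, Pi.single_apply]
      conv_lhs => rw [hdec]
      rw [map_sum]
      simp [L, g, univFun_coordField_derivation, mul_comm]
    refine ⟨∑ i, ‖L i‖ * C i, fun x => ?_⟩
    rw [← norm_iteratedFDeriv_fderiv, hfd, iteratedFDeriv_sum fun i _ =>
      (L i).contDiff.comp ((hg i).of_le (by exact_mod_cast le_top)), Finset.sum_apply]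
    refine (mul_le_mul_of_nonneg_left (norm_sum_le _ _) (by positivity)).trans ?_
    rw [Finset.mul_sum]
    refine Finset.sum_le_sum fun i _ => ?_
    have h1 := (L i).norm_iteratedFDeriv_comp_left (n := m) (hg i).contDiffAt (x := x)
      (by exact_mod_cast le_top)
    calc ‖x‖ ^ k * ‖iteratedFDeriv ℝ m (L i ∘ g i) x‖
        ≤ ‖x‖ ^ k * (‖L i‖ * ‖iteratedFDeriv ℝ m (g i) x‖) :=
          mul_le_mul_of_nonneg_left h1 (by positivity)
      _ = ‖L i‖ * (‖x‖ ^ k * ‖iteratedFDeriv ℝ m (g i) x‖) := by ring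
      _ ≤ ‖L i‖ * C i := mul_le_mul_of_nonneg_left (hC i x) (L i).opNorm_nonneg

/-- Algebraic differential operators preserve classical Schwartz functions. -/
lemma exists_schwartzMap_eq_apply
    {D : Module.End ℝ (SmoothFun (Set.univ : Set (EuclideanSpace ℝ (Fin n))))}
    (hD : D ∈ algebraicDiffOp (Set.univ : Set (EuclideanSpace ℝ (Fin n)))) :
    ∀ φ : SmoothFun (Set.univ : Set (EuclideanSpace ℝ (Fin n))),
      (∃ s : 𝓢(EuclideanSpace ℝ (Fin n), ℝ), univFun φ = s) →
        ∃ s : 𝓢(EuclideanSpace ℝ (Fin n), ℝ), univFun (D φ) = s := by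
  induction hD using Algebra.adjoin_induction with
  | mem D hD =>
    rintro φ ⟨s, hs⟩
    rcases hD with ⟨f, ⟨p, hp⟩, rfl⟩ | ⟨X, hX, rfl⟩
    · refine ⟨SchwartzMap.smulLeftCLM ℝ (polyEval p) s, funext fun x => ?_⟩
      rw [SchwartzMap.smulLeftCLM_apply_apply (hasTemperateGrowth_polyEval p), ← hs, smul_eq_mul,
        ← hp ⟨x, Set.mem_univ x⟩]
      rfl
    · choose p hp using hX
      refine ⟨∑ i, SchwartzMap.smulLeftCLM ℝ (polyEval (p i))
        (∂_{(EuclideanSpace.single i (1 : ℝ) : EuclideanSpace ℝ (Fin n))} s), funext fun x => ?_⟩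
      have h1 := X.derivFun_eq φ ⟨x, Set.mem_univ x⟩ (isSmoothExtensionAt_univFun φ _)
      have hdec : X.toFun ⟨x, Set.mem_univ x⟩ =
          ∑ i, X.toFun ⟨x, Set.mem_univ x⟩ i • EuclideanSpace.single i (1 : ℝ) := by
        ext j
        simp [Finset.sum_apply, Pi.single_apply]
      rw [hdec, map_sum] at h1
      refine h1.trans ?_
      rw [sum_apply]
      refine Finset.sum_congr rfl fun i _ => ?_
      rw [SchwartzMap.smulLeftCLM_apply_apply (hasTemperateGrowth_polyEval (p i)),
        SchwartzMap.lineDerivOp_apply_eq_fderiv, map_smul, hs]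
      exact congrArg (· • _) (hp i ⟨x, Set.mem_univ x⟩)
  | algebraMap r =>
    rintro φ ⟨s, hs⟩
    exact ⟨r • s, funext fun x => congrArg (r * ·) (congrFun hs x)⟩
  | add A B _ _ hA hB =>
    intro φ hφ
    obtain ⟨s, hs⟩ := hA φ hφ
    obtain ⟨t, ht⟩ := hB φ hφ
    exact ⟨s + t, funext fun x => congrArg₂ (· + ·) (congrFun hs x) (congrFun ht x)⟩
  | mul A B _ _ hA hB => exact fun φ hφ => hA _ (hB φ hφ)

theorem schwartzFun_univ :
    {f : EuclideanSpace ℝ (Fin n) → ℝ |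
      ∃ φ ∈ schwartzFun (Set.univ : Set (EuclideanSpace ℝ (Fin n))),
        ∀ x, φ.1 ⟨x, Set.mem_univ x⟩ = f x} =
    Set.range fun (f : 𝓢(EuclideanSpace ℝ (Fin n), ℝ)) (x : EuclideanSpace ℝ (Fin n)) => f x := by
  rw [isSmoothRealAffineVariety_univ.schwartzFun_eq]
  ext f
  constructor
  · rintro ⟨φ, hφ, hf⟩
    refine ⟨⟨univFun φ, contDiff_univFun φ, fun k m => exists_pow_mul_norm_iteratedFDeriv_le m hφ k⟩,
      funext hf⟩
  · rintro ⟨s, rfl⟩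
    let φ : SmoothFun (Set.univ : Set (EuclideanSpace ℝ (Fin n))) :=
      ⟨fun x => s x, fun x => ⟨s, s.smooth ⊤, Eventually.of_forall fun _ => rfl⟩⟩
    refine ⟨φ, fun D hD => ?_, fun x => rfl⟩
    -- Since `D φ` is again a Schwartz function, its zeroth seminorm bounds it.
    obtain ⟨t, ht⟩ := exists_schwartzMap_eq_apply hD φ ⟨s, rfl⟩
    obtain ⟨C, -, hC⟩ := t.decay 0 0
    refine ⟨C, fun x => ?_⟩
    have h1 : (D φ).1 x = t x := congrFun ht x
    have h2 := hC x
    rwa [pow_zero, one_mul, norm_iteratedFDeriv_zero, Real.norm_eq_abs, ← h1] at h2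

end ClassicalSchwartz

theorem mainTheorem10 :
    (∀ (n : ℕ) (M : Set (EuclideanSpace ℝ (Fin n))), IsSmoothRealAffineVariety M →
      schwartzFun M =
        {φ : SmoothFun M | ∀ D ∈ algebraicDiffOp M, ∃ C : ℝ, ∀ x : M, |(D φ).1 x| ≤ C}) ∧
    (∀ n : ℕ,
      {f : EuclideanSpace ℝ (Fin n) → ℝ |
          ∃ φ ∈ schwartzFun (Set.univ : Set (EuclideanSpace ℝ (Fin n))),
            ∀ x, φ.1 ⟨x, Set.mem_univ x⟩ = f x} =
        Set.range fun (f : 𝓢(EuclideanSpace ℝ (Fin n), ℝ)) (x : EuclideanSpace ℝ (Fin n)) =>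
          f x) :=
  ⟨fun _ _ hM => hM.schwartzFun_eq, fun _ => schwartzFun_univ⟩
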